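/- Let $q:\mathbb R\to(0,\infty)$ be a positive, bounded, Lipschitz continuous probability density with $\int_{\mathbb R}|x|q(x)\,dx<\infty$. Let $h:\mathbb R\to\mathbb R$ be measurable and suppose that for some $r\in(0,1)$ and $C\in\mathbb R$ we have $|h(x)|\le r|x|$ whenever $|x|\ge C$, and that $h$ is bounded on $\{|x|\le C\}$. Consider the Markov chain $$X_j=h(X_{j-1})+\varepsilon_j,\qquad j\ge 1,$$ where $\varepsilon_1,\varepsilon_2,\dots$ are i.i.d. with density $q$ and independent of $X_0$. Then: (1) The chain has a unique invariant probability measure. It has a density $p$, which can be chosen positive, bounded and Lipschitz continuous on $\mathbb R$, and every invariant probability density equals $p$ almost everywhere. (2) Let $f:\mathbb R\to\mathbb R$ be measurable with $\mathbb E|f(\varepsilon_1)|<\infty$, and suppose that for some constant $C'$, $$\sup_{z,x\in[0,1/n]}|f(z-h(x))|\le C'$$ for all $n$ large enough. Let $(X_j)_{j\ge0}$ be stationary and put $$S_n=\sum_{j=1}^n f(\varepsilon_j)\mathbf 1\{X_{j-1}\in[0,1/n]\}.$$ Then $S_n$ converges in distribution, as $n\to\infty$, to the compound Poisson variable $S=\sum_{i=1}^{N}\xi_i$,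 where $N$ is Poisson with mean $p(0)$ and is independent of the i.i.d. variables $\xi_1,\xi_2,\dots$, each distributed as $f(\varepsilon_1)$. Moreover there are a constant $K>0$ and an $n_0$, depending only on $q$, $h$ and $f$, such that for all $n\ge n_0$ $$L\big(\mathrm{Law}(S_n),\mathrm{Law}(S)\big)\le K\,n^{-1/2}\log n,$$ where for laws with distribution functions $G$ and $F$, $L(G,F)=\inf\{a>0: G(x-a)-a\le F(x)\le G(x+a)+a\ \text{for all }x\in\mathbb R\}$ is the Lévy distance. -/

import Mathlib

open MeasureTheory ProbabilityTheory Filter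
open scoped NNReal ENNReal Topology

/-- The measure on `ℝ` with (nonnegative) density `q` with respect to Lebesgue measure. -/
noncomputable def densityMeasure (q : ℝ → ℝ) : Measure ℝ :=
  volume.withDensity fun x => ENNReal.ofReal (q x)

/-- `q` is a probability density on `ℝ`. -/
structure IsProbDensity (q : ℝ → ℝ) : Prop where
  measurable : Measurable q
  nonneg : ∀ x, 0 ≤ q x
  lintegral_eq_one : ∫⁻ x, ENNReal.ofReal (q x) = 1

/-- The transition kernel of the recursion `X_j = h(X_{j-1}) + ε_j` whose noise has density `q`:
`arKernel h hh q x` is the law of `h x + ε`, where `ε` has density `q`. -/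
noncomputable def arKernel (h : ℝ → ℝ) (hh : Measurable h) (q : ℝ → ℝ) : Kernel ℝ ℝ where
  toFun x := (densityMeasure q).map fun y => h x + y
  measurable' := by
    have : SFinite (densityMeasure q) := by unfold densityMeasure; infer_instance
    refine Measure.measurable_of_measurable_coe _ fun s hs => ?_
    have hm : Measurable fun z : ℝ × ℝ => h z.1 + z.2 := by fun_prop
    have hs' := measurable_measure_prodMk_left (ν := densityMeasure q) (hm hs)
    have he : (fun x => (densityMeasure q).map (fun y => h x + y) s) =
        fun x => densityMeasure q (Prod.mk x ⁻¹' ((fun z : ℝ × ℝ => h z.1 + z.2) ⁻¹' s)) := by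
      funext x
      rw [Measure.map_apply (by fun_prop) hs]
      rfl
    rw [he]
    exact hs'

/-- `p` is an invariant (probability) density of the chain `X_j = h(X_{j-1}) + ε_j`. -/
def IsInvariantDensity (h : ℝ → ℝ) (hh : Measurable h) (q p : ℝ → ℝ) : Prop :=
  IsProbDensity p ∧ (arKernel h hh q).Invariant (densityMeasure p)

/-- `(X_j)_{j ≥ 0}` is a stationary solution of `X_{j+1} = h(X_j) + ε_{j+1}`, where
`ε_1, ε_2, …` are i.i.d. with density `q` and independent of `X_0`.
The noise variable `ε_{j+1}` is written `ε j`. -/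
structure IsStationaryAR {Ω : Type*} [MeasurableSpace Ω] (P : Measure Ω)
    (h q : ℝ → ℝ) (ε X : ℕ → Ω → ℝ) : Prop where
  measurable_noise : ∀ j, Measurable (ε j)
  measurable_state : ∀ j, Measurable (X j)
  law_noise : ∀ j, P.map (ε j) = densityMeasure q
  iIndep_noise : iIndepFun ε P
  indep_init : IndepFun (X 0) (fun ω j => ε j ω) P
  recursion : ∀ j ω, X (j + 1) ω = h (X j ω) + ε j ω
  stationary : ∀ k, P.map (fun ω j => X (j + k) ω) = P.map (fun ω j => X j ω)

/-- `S_n = ∑_{j=1}^n f(ε_j) 1{X_{j-1} ∈ [0, 1/n]}` (recall that `ε_{j+1}` is written `ε j`). -/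
noncomputable def arSum {Ω : Type*} (f : ℝ → ℝ) (ε X : ℕ → Ω → ℝ) (n : ℕ) (ω : Ω) : ℝ :=
  ∑ j ∈ Finset.range n, f (ε j ω) * (Set.Icc (0 : ℝ) (1 / (n : ℝ))).indicator 1 (X j ω)

/-- The `k`-fold convolution power: the law of a sum of `k` i.i.d. variables with law `ν`. -/
noncomputable def convPow (ν : Measure ℝ) : ℕ → Measure ℝ
  | 0 => Measure.dirac 0
  | k + 1 => (convPow ν k).conv ν

/-- The compound Poisson law with intensity `m` and jump law `ν`: the law of
`ξ_1 + … + ξ_N`, where `N` is Poisson with mean `m` and independent of the i.i.d. `ξ_i ∼ ν`. -/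
noncomputable def compoundPoisson (m : ℝ≥0) (ν : Measure ℝ) : Measure ℝ :=
  (poissonMeasure m).bind (convPow ν)

/-- The Lévy distance between (the distribution functions `F` and `G` of) two laws on `ℝ`. -/
noncomputable def levyDist (μ ν : Measure ℝ) : ℝ :=
  sInf {a : ℝ | 0 < a ∧ ∀ x : ℝ,
    μ.real (Set.Iic (x - a)) - a ≤ ν.real (Set.Iic x) ∧
    ν.real (Set.Iic x) ≤ μ.real (Set.Iic (x + a)) + a}

/-! Ergodicity. The bound `|h x| ≤ r * |x| + M` makes `|x|` a Lyapunov function, and a positive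
continuous `q` gives a minorization on each set `|x| ≤ R`. Harris' theorem, in the form of a
contraction of a weighted oscillation seminorm (`harris_contraction`, `harris_convergence`), makes
the iterates of the transition operator on a bounded function converge geometrically to a constant.
Started at 0, the chain has densities `p n y` which are such iterates of `z ↦ q (y - h z)`, so they
converge pointwise; bounded first moments prevent loss of mass. One more step of the chain gives a
version `y ↦ ∫ q (y - h z)` of the limit that inherits positivity, the bound and the Lipschitz
constant of `q`.

Poisson limit. Let `s = [0, 1/n]`, let `π = p(0)/n + O(n⁻²)` be its stationary mass, and let `T_k`
be the sum up to time `k`. A Lindeberg telescope (`abs_integral_hitSum_sub_le`) replaces the chain,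
step by step, by a random walk that jumps with probability `π`, with the law of `f(ε)`. Since `ε_k`
is independent of the past and of `X_k`, the error of one replacement is `E[(1_s(X_k) - π) w(T_k)]`
with `w` bounded. Passing from `T_k` to `T_{k-m}` costs `O(m/n²)`, because two visits to `s` are
that unlikely; after that, mixing leaves `O(ρ^m)`. With `m` of order `log n`, the `n` errors sum to
`O(log n / n)`.

The lazy walk is compared with the compound Poisson law by Le Cam's inequality in a Banach algebra
(`norm_pow_sub_exp_le`), at cost `O(1/n)`. All bounds are uniform over measurable test functions
with a given bound. They therefore give both weak convergence and a uniform bound `O(log n / n)`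
between distribution functions, which is stronger than the stated Lévy rate. -/

/-! ### Harris' theorem by contraction of a weighted oscillation seminorm. -/

section Harris

/-- Every value of `ψ - G` lies below every value of `ψ + G`, so the supremum of the former serves
as centre. This lets a contraction towards constants be checked on pairs of points. -/
lemma exists_center_of_abs_sub_le {α : Type*} {ψ G : α → ℝ}
    (h : ∀ x y, |ψ x - ψ y| ≤ G x + G y) : ∃ a, ∀ x, |ψ x - a| ≤ G x := by
  rcases isEmpty_or_nonempty α with he | he
  · exact ⟨0, fun x => he.elim x⟩
  have hb : ∀ x y, ψ x - G x ≤ ψ y + G y := fun x y => by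
    have := (abs_le.mp (h x y)).2; linarith
  refine ⟨⨆ x, (ψ x - G x), fun y => abs_le.mpr ⟨?_, ?_⟩⟩
  · have : ⨆ x, (ψ x - G x) ≤ ψ y + G y := ciSup_le fun x => hb x y
    linarith
  · have : ψ y - G y ≤ ⨆ x, (ψ x - G x) :=
      le_ciSup (f := fun x => ψ x - G x) ⟨ψ y + G y, by rintro _ ⟨x, rfl⟩; exact hb x y⟩ y
    linarith

variable {α : Type*} [MeasurableSpace α]

/-- The action `φ ↦ ∫ φ(y) κ(·, dy)` of a kernel on real functions. -/
noncomputable def transOp (κ : Kernel α α) (φ : α → ℝ) (x : α) : ℝ := ∫ y, φ y ∂κ x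

lemma measurable_transOp (κ : Kernel α α) [IsSFiniteKernel κ] {φ : α → ℝ} (hφ : Measurable φ) :
    Measurable (transOp κ φ) :=
  (hφ.stronglyMeasurable.integral_kernel (κ := κ)).measurable

lemma abs_transOp_le (κ : Kernel α α) [IsMarkovKernel κ] {φ : α → ℝ} {B : ℝ}
    (hB : ∀ x, |φ x| ≤ B) (x : α) : |transOp κ φ x| ≤ B := by
  have := norm_integral_le_of_norm_le_const (μ := κ x) (f := φ) (C := B)
    (Eventually.of_forall hB)
  simpa [transOp] using this

lemma measurable_iterate_transOp (κ : Kernel α α) [IsSFiniteKernel κ] {φ : α → ℝ}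
    (hφ : Measurable φ) (n : ℕ) : Measurable ((transOp κ)^[n] φ) := by
  induction n with
  | zero => exact hφ
  | succ n ih => rw [Function.iterate_succ_apply']; exact measurable_transOp κ ih

lemma abs_iterate_transOp_le (κ : Kernel α α) [IsMarkovKernel κ] {φ : α → ℝ} {B : ℝ}
    (hB : ∀ x, |φ x| ≤ B) (n : ℕ) (x : α) : |(transOp κ)^[n] φ x| ≤ B := by
  induction n generalizing x with
  | zero => exact hB x
  | succ n ih => rw [Function.iterate_succ_apply']; exact abs_transOp_le κ ih x

lemma integrable_of_abs_le {μ : Measure α} [IsFiniteMeasure μ] {φ : α → ℝ} (hφ : Measurable φ)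
    {B : ℝ} (hB : ∀ x, |φ x| ≤ B) : Integrable φ μ :=
  Integrable.of_bound hφ.aestronglyMeasurable B (Eventually.of_forall hB)

lemma abs_integral_le_of_abs_le {μ : Measure α} {f G : α → ℝ} (hG : Integrable G μ)
    (h : ∀ x, |f x| ≤ G x) : |∫ x, f x ∂μ| ≤ ∫ x, G x ∂μ :=
  norm_integral_le_of_norm_le (f := f) hG (Eventually.of_forall h)

/-- The difference is an integral over the positive measure `μ - ν`. This is the coupling step: mass
`ν` shared by two transition laws cancels. -/
lemma abs_integral_sub_integral_le_of_le {μ ν : Measure α} [IsFiniteMeasure μ] [IsFiniteMeasure ν]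
    (hle : ν ≤ μ) {ψ G : α → ℝ} (hψ : Integrable ψ μ) (hG : Integrable G μ)
    (hψG : ∀ x, |ψ x| ≤ G x) :
    |∫ x, ψ x ∂μ - ∫ x, ψ x ∂ν| ≤ ∫ x, G x ∂μ - ∫ x, G x ∂ν := by
  have hμ : (μ - ν) + ν = μ := Measure.sub_add_cancel_of_le hle
  have hs : μ - ν ≤ μ := Measure.sub_le
  have key : ∀ g : α → ℝ, Integrable g μ → ∫ x, g x ∂μ - ∫ x, g x ∂ν = ∫ x, g x ∂(μ - ν) := by
    intro g hg
    have := integral_add_measure (hg.mono_measure hs) (hg.mono_measure hle)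
    rw [hμ] at this
    linarith
  rw [key ψ hψ, key G hG]
  exact abs_integral_le_of_abs_le (hG.mono_measure hs) hψG

/-- For a pair with `V x + V y ≥ R` the drift alone contracts. For the remaining pairs both points
lie in `V ≤ R`, and cancelling the common part `ν` gains `2c`, against a loss `2βK` from the drift;
a small weight `β` makes the gain win. -/
theorem harris_contraction (κ : Kernel α α) [IsMarkovKernel κ] {V : α → ℝ}
    (hV0 : ∀ x, 0 ≤ V x) {γ K : ℝ} (hγ0 : 0 ≤ γ) (hγ1 : γ < 1) (hK : 0 ≤ K)
    (hVi : ∀ x, Integrable V (κ x)) (hdrift : ∀ x, ∫ y, V y ∂κ x ≤ γ * V x + K)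
    (hmin : ∀ R : ℝ, ∃ ν : Measure α, IsFiniteMeasure ν ∧ ν ≠ 0 ∧ ∀ x, V x ≤ R → ν ≤ κ x) :
    ∃ β > 0, ∃ ρ, 0 ≤ ρ ∧ ρ < 1 ∧ ∀ A, 0 ≤ A → ∀ φ : α → ℝ, Measurable φ →
      (∃ a, ∀ x, |φ x - a| ≤ A * (1 + β * V x)) →
      ∃ a, ∀ x, |transOp κ φ x - a| ≤ ρ * A * (1 + β * V x) := by
  have h1γ : 0 < 1 - γ := by linarith
  -- Chosen so that `2K ≤ (1 - γ)(V x + V y) / 2` beyond `R`: the additive constant is absorbed at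
  -- the price of replacing `γ` by `δ = (1 + γ) / 2`.
  set R : ℝ := 4 * K / (1 - γ) + 1 with hR
  have hR0 : 0 < R := by positivity
  obtain ⟨ν, hνf, hν0, hν⟩ := hmin R
  set c : ℝ := ν.real Set.univ with hc
  have hc0 : 0 < c := by
    have : ν.real Set.univ ≠ 0 := by simpa [Measure.real, ENNReal.toReal_eq_zero_iff] using hν0
    exact lt_of_le_of_ne measureReal_nonneg this.symm
  set β : ℝ := c / (2 * K + 1) with hβ
  have hβ0 : 0 < β := by positivity
  have hβK : 2 * (β * K) ≤ c := by
    have : β * (2 * K + 1) = c := by rw [hβ]; field_simp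
    nlinarith
  set δ : ℝ := (1 + γ) / 2 with hδ
  -- The ratio `(2 + βtδ) / (2 + βt)` decreases in `t`, so its value at `t = R` is the worst one for
  -- large pairs.
  set ρ₁ : ℝ := (2 + β * R * δ) / (2 + β * R) with hρ₁
  have hden : 0 < 2 + β * R := by positivity
  have hρ₁1 : ρ₁ < 1 := by
    rw [hρ₁, div_lt_one hden]
    have : β * R * δ < β * R * 1 := by
      apply mul_lt_mul_of_pos_left _ (by positivity)
      rw [hδ]; linarith
    linarith
  refine ⟨β, hβ0, max (max (1 - c / 2) γ) ρ₁, le_max_of_le_left (le_max_of_le_right hγ0),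
    max_lt (max_lt (by linarith) hγ1) hρ₁1, fun A hA φ hφ ⟨a, ha⟩ => ?_⟩
  set ρ : ℝ := max (max (1 - c / 2) γ) ρ₁ with hρ
  have hρc : 1 - c / 2 ≤ ρ := le_max_of_le_left (le_max_left _ _)
  have hργ : γ ≤ ρ := le_max_of_le_left (le_max_right _ _)
  have hρρ₁ : ρ₁ ≤ ρ := le_max_right _ _
  have hGi : ∀ x, Integrable (fun y => A * (1 + β * V y)) (κ x) := fun x =>
    (((integrable_const 1).add ((hVi x).const_mul β))).const_mul A
  have hψi : ∀ x, Integrable (fun y => φ y - a) (κ x) := fun x =>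
    (hGi x).mono' (hφ.sub_const a).aestronglyMeasurable (Eventually.of_forall ha)
  have hφi : ∀ x, Integrable φ (κ x) := fun x => by
    have := (hψi x).add (integrable_const (μ := κ x) a)
    exact this.congr (Eventually.of_forall fun y => by simp)
  have hT : ∀ x, ∫ y, (φ y - a) ∂κ x = transOp κ φ x - a := fun x => by
    rw [integral_sub (hφi x) (integrable_const a)]; simp [transOp]
  have hGint : ∀ x, ∫ y, A * (1 + β * V y) ∂κ x ≤ A * (1 + β * (γ * V x + K)) := fun x => by
    rw [integral_const_mul, integral_add (integrable_const 1) ((hVi x).const_mul β),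
      integral_const_mul]
    simp only [integral_const, probReal_univ, smul_eq_mul, mul_one]
    have := hdrift x
    gcongr
  apply exists_center_of_abs_sub_le
  intro x y
  have hs0 : 0 ≤ V x + V y := add_nonneg (hV0 x) (hV0 y)
  rcases le_total R (V x + V y) with hs | hs
  · have hx : |transOp κ φ x - a| ≤ A * (1 + β * (γ * V x + K)) := by
      rw [← hT x]
      exact (abs_integral_le_of_abs_le (hGi x) ha).trans (hGint x)
    have hy : |transOp κ φ y - a| ≤ A * (1 + β * (γ * V y + K)) := by
      rw [← hT y]
      exact (abs_integral_le_of_abs_le (hGi y) ha).trans (hGint y)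
    have hxy : |transOp κ φ x - transOp κ φ y| ≤
        |transOp κ φ x - a| + |transOp κ φ y - a| := by
      rw [abs_sub_comm (transOp κ φ y) a]; exact abs_sub_le _ _ _
    have h2K : 2 * K ≤ (1 - γ) * (V x + V y) / 2 := by
      have : (1 - γ) * R = 4 * K + (1 - γ) := by rw [hR]; field_simp
      nlinarith [mul_le_mul_of_nonneg_left hs h1γ.le]
    have hstep : 2 + β * (V x + V y) * δ ≤ ρ₁ * (2 + β * (V x + V y)) := by
      rw [hρ₁, div_mul_eq_mul_div (2 + β * R * δ), le_div_iff₀ hden]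
      have h1 : 0 ≤ β * (1 - δ) * (V x + V y - R) := by
        have : 0 ≤ 1 - δ := by rw [hδ]; linarith
        have : 0 ≤ V x + V y - R := by linarith
        positivity
      nlinarith
    have h3 : 2 + 2 * (β * K) + β * γ * (V x + V y) ≤ ρ * (2 + β * (V x + V y)) := by
      have h4 : 2 + 2 * (β * K) + β * γ * (V x + V y) ≤ 2 + β * (V x + V y) * δ := by
        rw [hδ]; nlinarith [mul_le_mul_of_nonneg_left h2K hβ0.le]
      have h5 : ρ₁ * (2 + β * (V x + V y)) ≤ ρ * (2 + β * (V x + V y)) :=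
        mul_le_mul_of_nonneg_right hρρ₁ (by positivity)
      linarith
    have h6 := mul_le_mul_of_nonneg_left h3 hA
    calc _ ≤ A * (1 + β * (γ * V x + K)) + A * (1 + β * (γ * V y + K)) := by linarith
      _ = A * (2 + 2 * (β * K) + β * γ * (V x + V y)) := by ring
      _ ≤ _ := h6
      _ = _ := by ring
  -- The same `I` is removed at both points, so it disappears from the difference.
  · set I : ℝ := ∫ z, (φ z - a) ∂ν with hI
    have hmain : ∀ z, V z ≤ R → |transOp κ φ z - a - I| ≤ A * (1 - c + β * (γ * V z + K)) := by
      intro z hz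
      have h1 := abs_integral_sub_integral_le_of_le (hν z hz) (hψi z) (hGi z) ha
      rw [hT z] at h1
      have h2 : A * c ≤ ∫ y, A * (1 + β * V y) ∂ν := by
        have h3 : ∫ _, A ∂ν = A * c := by simp [hc, mul_comm]
        rw [← h3]
        refine integral_mono (integrable_const A) ((hGi z).mono_measure (hν z hz)) fun y => ?_
        exact le_mul_of_one_le_right hA (by have := mul_nonneg hβ0.le (hV0 y); linarith)
      have h4 := hGint z
      calc _ ≤ _ := h1
        _ ≤ A * (1 + β * (γ * V z + K)) - A * c := by linarith
        _ = _ := by ring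
    have hx := hmain x (by linarith [hV0 y])
    have hy := hmain y (by linarith [hV0 x])
    have hxy : |transOp κ φ x - transOp κ φ y| ≤
        |transOp κ φ x - a - I| + |transOp κ φ y - a - I| := by
      have := abs_sub_le (transOp κ φ x) (a + I) (transOp κ φ y)
      rw [abs_sub_comm (a + I)] at this
      simpa [sub_sub] using this
    have h3 : 2 - 2 * c + 2 * (β * K) + β * γ * (V x + V y) ≤ ρ * (2 + β * (V x + V y)) := by
      have h5 : γ * (β * (V x + V y)) ≤ ρ * (β * (V x + V y)) :=
        mul_le_mul_of_nonneg_right hργ (by positivity)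
      nlinarith
    have h6 := mul_le_mul_of_nonneg_left h3 hA
    calc _ ≤ A * (1 - c + β * (γ * V x + K)) + A * (1 - c + β * (γ * V y + K)) := by linarith
      _ = A * (2 - 2 * c + 2 * (β * K) + β * γ * (V x + V y)) := by ring
      _ ≤ _ := h6
      _ = _ := by ring

/-- **Harris' theorem**: geometric convergence of the iterates of a kernel satisfying a drift and
a minorization condition, uniformly over bounded test functions. -/
theorem harris_convergence (κ : Kernel α α) [IsMarkovKernel κ] [Nonempty α] {V : α → ℝ}
    (hV0 : ∀ x, 0 ≤ V x) {γ K : ℝ} (hγ0 : 0 ≤ γ) (hγ1 : γ < 1) (hK : 0 ≤ K)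
    (hVi : ∀ x, Integrable V (κ x)) (hdrift : ∀ x, ∫ y, V y ∂κ x ≤ γ * V x + K)
    (hmin : ∀ R : ℝ, ∃ ν : Measure α, IsFiniteMeasure ν ∧ ν ≠ 0 ∧ ∀ x, V x ≤ R → ν ≤ κ x) :
    ∃ D ρ : ℝ, 0 ≤ D ∧ 0 < ρ ∧ ρ < 1 ∧ ∀ B, 0 ≤ B → ∀ φ : α → ℝ, Measurable φ →
      (∀ x, |φ x| ≤ B) →
      ∃ l : ℝ, ∀ (n : ℕ) x, |(transOp κ)^[n] φ x - l| ≤ D * B * ρ ^ n * (1 + V x) := by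
  obtain ⟨β, hβ, ρ, hρ0, hρ1, hcontr⟩ :=
    harris_contraction κ hV0 hγ0 hγ1 hK hVi hdrift hmin
  obtain ⟨x₀⟩ := ‹Nonempty α›
  -- Keeps the rate strictly positive, so that its logarithm can be used later.
  set ρ' : ℝ := max ρ (1 / 2) with hρ'
  have hρ'0 : 0 < ρ' := lt_max_of_lt_right (by norm_num)
  have hρ'1 : ρ' < 1 := max_lt hρ1 (by norm_num)
  set E : ℝ := (1 + β * (γ * V x₀ + K)) + (1 + β * V x₀) with hE
  have hE0 : 0 ≤ E := by have := hV0 x₀; positivity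
  have hE1 : 0 ≤ E / (1 - ρ') := div_nonneg hE0 (by linarith)
  -- The summand 1 is the distance to the centre `a n`, the other the geometric tail from `a n` to
  -- the limit; `1 + β` converts the weight `1 + βV` into `1 + V`.
  refine ⟨(1 + E / (1 - ρ')) * (1 + β), ρ', by positivity, hρ'0, hρ'1,
    fun B hB φ hφ hφB => ?_⟩
  have hiter : ∀ n : ℕ, ∃ a, ∀ x, |(transOp κ)^[n] φ x - a| ≤ ρ' ^ n * B * (1 + β * V x) := by
    intro n
    induction n with
    | zero =>
      refine ⟨0, fun x => ?_⟩
      have h1 : 0 ≤ B * (β * V x) := by have := hV0 x; positivity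
      have h2 := hφB x
      simp only [Function.iterate_zero, id_eq, sub_zero, pow_zero, one_mul]
      nlinarith
    | succ n ih =>
      obtain ⟨a, ha⟩ := hcontr _ (by positivity) _ (measurable_iterate_transOp κ hφ n) ih
      refine ⟨a, fun x => ?_⟩
      rw [Function.iterate_succ_apply']
      refine (ha x).trans ?_
      have h1 : ρ * (ρ' ^ n * B * (1 + β * V x)) ≤ ρ' * (ρ' ^ n * B * (1 + β * V x)) := by
        apply mul_le_mul_of_nonneg_right (le_max_left _ _)
        have := hV0 x; positivity
      calc _ = ρ * (ρ' ^ n * B * (1 + β * V x)) := by ring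
        _ ≤ _ := h1
        _ = _ := by ring
  choose a ha using hiter
  -- Successive centres are both close to the value of iterate `n + 1` at `x₀`: `a n` after
  -- averaging over `κ x₀`, and `a (n + 1)` directly.
  have hstep : ∀ n, dist (a n) (a (n + 1)) ≤ B * E * ρ' ^ n := by
    intro n
    have h1 : |(transOp κ)^[n + 1] φ x₀ - a n| ≤ ρ' ^ n * B * (1 + β * (γ * V x₀ + K)) := by
      have hGi : Integrable (fun y => ρ' ^ n * B * (1 + β * V y)) (κ x₀) :=
        (((integrable_const 1).add ((hVi x₀).const_mul β))).const_mul _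
      have hmi := measurable_iterate_transOp κ hφ n
      have h2 : ∫ y, ((transOp κ)^[n] φ y - a n) ∂κ x₀ = (transOp κ)^[n + 1] φ x₀ - a n := by
        rw [integral_sub (integrable_of_abs_le hmi (abs_iterate_transOp_le κ hφB n))
          (integrable_const _), Function.iterate_succ_apply']
        simp [transOp]
      rw [← h2]
      refine (abs_integral_le_of_abs_le hGi (ha n)).trans ?_
      rw [integral_const_mul, integral_add (integrable_const 1) ((hVi x₀).const_mul β),
        integral_const_mul]
      simp only [integral_const, probReal_univ, smul_eq_mul, mul_one]
      have := hdrift x₀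
      gcongr
    have h2 := ha (n + 1) x₀
    have h3 : ρ' ^ (n + 1) * B * (1 + β * V x₀) ≤ ρ' ^ n * B * (1 + β * V x₀) := by
      have h4 : ρ' ^ (n + 1) ≤ ρ' ^ n := pow_le_pow_of_le_one hρ'0.le hρ'1.le n.le_succ
      have := hV0 x₀
      gcongr
    have h5 := abs_sub_le (a n) ((transOp κ)^[n + 1] φ x₀) (a (n + 1))
    rw [abs_sub_comm (a n) ((transOp κ)^[n + 1] φ x₀)] at h5
    rw [Real.dist_eq]
    calc _ ≤ ρ' ^ n * B * (1 + β * (γ * V x₀ + K)) + ρ' ^ n * B * (1 + β * V x₀) := by linarith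
      _ = _ := by rw [hE]; ring
  obtain ⟨l, hl⟩ := cauchySeq_tendsto_of_complete (cauchySeq_of_le_geometric ρ' _ hρ'1 hstep)
  refine ⟨l, fun n x => ?_⟩
  have h1 := dist_le_of_le_geometric_of_tendsto ρ' _ hρ'1 hstep hl n
  rw [Real.dist_eq] at h1
  have h2 := abs_sub_le ((transOp κ)^[n] φ x) (a n) l
  have h3 := ha n x
  have hVx := hV0 x
  have h4 : 1 + β * V x ≤ (1 + β) * (1 + V x) := by nlinarith
  have h5 : 1 ≤ (1 + β) * (1 + V x) := by nlinarith [mul_nonneg hβ.le hVx]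
  have hQ : 0 ≤ ρ' ^ n * B := by positivity
  have h6 : ρ' ^ n * B * (1 + β * V x) ≤ ρ' ^ n * B * ((1 + β) * (1 + V x)) :=
    mul_le_mul_of_nonneg_left h4 hQ
  have h7 : B * E * ρ' ^ n / (1 - ρ') ≤
      ρ' ^ n * B * (E / (1 - ρ')) * ((1 + β) * (1 + V x)) := by
    have : B * E * ρ' ^ n / (1 - ρ') = ρ' ^ n * B * (E / (1 - ρ')) := by ring
    rw [this]
    exact le_mul_of_one_le_right (by positivity) h5
  calc _ ≤ ρ' ^ n * B * ((1 + β) * (1 + V x)) +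
        ρ' ^ n * B * (E / (1 - ρ')) * ((1 + β) * (1 + V x)) := by linarith
    _ = _ := by ring

end Harris

/-! ### Measures given by a density. -/

section Density

lemma IsProbDensity.isProbabilityMeasure {q : ℝ → ℝ} (hq : IsProbDensity q) :
    IsProbabilityMeasure (densityMeasure q) :=
  ⟨by rw [densityMeasure, withDensity_apply _ MeasurableSet.univ, Measure.restrict_univ,
    hq.lintegral_eq_one]⟩

instance (q : ℝ → ℝ) : SFinite (densityMeasure q) := by unfold densityMeasure; infer_instance

lemma lintegral_densityMeasure {q : ℝ → ℝ} (hq : Measurable q) {φ : ℝ → ℝ≥0∞}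
    (hφ : Measurable φ) :
    ∫⁻ x, φ x ∂densityMeasure q = ∫⁻ x, ENNReal.ofReal (q x) * φ x := by
  rw [densityMeasure, lintegral_withDensity_eq_lintegral_mul _ hq.ennreal_ofReal hφ]
  rfl

lemma integral_densityMeasure {q : ℝ → ℝ} (hq : Measurable q) (hq0 : ∀ x, 0 ≤ q x) (φ : ℝ → ℝ) :
    ∫ x, φ x ∂densityMeasure q = ∫ x, q x * φ x := by
  rw [densityMeasure, integral_withDensity_eq_integral_toReal_smul hq.ennreal_ofReal (by simp)]
  simp only [ENNReal.toReal_ofReal (hq0 _), smul_eq_mul]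

lemma densityMeasure_le_of_le {q q' : ℝ → ℝ} (h : ∀ x, q x ≤ q' x) :
    densityMeasure q ≤ densityMeasure q' :=
  withDensity_mono (Eventually.of_forall fun x => ENNReal.ofReal_le_ofReal (h x))

end Density

/-! ### The autoregressive kernel: densities, drift, minorization, invariance. -/

section ARKernel

variable {h q : ℝ → ℝ} {hh : Measurable h}

lemma arKernel_apply (x : ℝ) : arKernel h hh q x = (densityMeasure q).map fun y => h x + y := rfl

lemma isMarkovKernel_arKernel (hh : Measurable h) (hq : IsProbDensity q) :
    IsMarkovKernel (arKernel h hh q) := by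
  have := hq.isProbabilityMeasure
  exact ⟨fun x => by rw [arKernel_apply]; exact Measure.isProbabilityMeasure_map (by fun_prop)⟩

lemma lintegral_arKernel (x : ℝ) {φ : ℝ → ℝ≥0∞} (hφ : Measurable φ) :
    ∫⁻ y, φ y ∂arKernel h hh q x = ∫⁻ e, φ (h x + e) ∂densityMeasure q := by
  rw [arKernel_apply, lintegral_map hφ (by fun_prop)]

lemma transOp_arKernel {φ : ℝ → ℝ} (hφ : Measurable φ) (x : ℝ) :
    transOp (arKernel h hh q) φ x = ∫ e, φ (h x + e) ∂densityMeasure q := by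
  rw [transOp, arKernel_apply, integral_map (by fun_prop) hφ.aestronglyMeasurable]

lemma arKernel_eq_densityMeasure (hq : Measurable q) (x : ℝ) :
    arKernel h hh q x = densityMeasure fun y => q (y - h x) := by
  have hq' : Measurable fun y => q (y - h x) := by fun_prop
  refine Measure.ext_of_lintegral _ fun φ hφ => ?_
  rw [lintegral_arKernel x hφ, lintegral_densityMeasure hq (by fun_prop),
    lintegral_densityMeasure hq' hφ,
    ← lintegral_add_left_eq_self (fun y => ENNReal.ofReal (q (y - h x)) * φ y) (h x)]
  simp only [add_sub_cancel_left]

lemma transOp_arKernel_le_of_bounded (hq : IsProbDensity q) {M : ℝ} (hM : ∀ x, q x ≤ M)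
    {s : Set ℝ} (hs : MeasurableSet s) (hsf : volume s ≠ ∞) (x : ℝ) :
    transOp (arKernel h hh q) (s.indicator 1) x ≤ M * volume.real s := by
  have hq' : Measurable fun y => q (y - h x) := hq.measurable.comp (by fun_prop)
  rw [transOp, arKernel_eq_densityMeasure hq.measurable,
    integral_densityMeasure hq' fun _ => hq.nonneg _]
  have h1 : ∫ y, s.indicator (fun _ => M) y = M * volume.real s := by
    rw [integral_indicator_const _ hs, smul_eq_mul, mul_comm]
  rw [← h1]
  have hi : Integrable (s.indicator fun _ => M) :=
    (integrable_indicator_iff hs).2 (integrableOn_const hsf)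
  refine integral_mono_of_nonneg (Eventually.of_forall fun y => ?_) hi
    (Eventually.of_forall fun y => ?_)
  · exact mul_nonneg (hq.nonneg _) (Set.indicator_nonneg (by simp) _)
  · by_cases hy : y ∈ s <;> simp [hy, hM]

/-- One step of the chain produces the density `y ↦ ∫ q (y - h z) μ(dz)`. -/
lemma bind_arKernel (hq : IsProbDensity q) {M : ℝ} (hM : ∀ x, q x ≤ M) (μ : Measure ℝ)
    [IsProbabilityMeasure μ] :
    μ.bind (arKernel h hh q) = densityMeasure fun y => ∫ z, q (y - h z) ∂μ := by
  have := isMarkovKernel_arKernel hh hq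
  have hqm := hq.measurable
  have hqj : Measurable fun z : ℝ × ℝ => q (z.1 - h z.2) := by fun_prop
  have hqj' : Measurable fun y => ∫ z, q (y - h z) ∂μ :=
    (hqj.stronglyMeasurable.integral_prod_right (ν := μ)).measurable
  refine Measure.ext_of_lintegral _ fun φ hφ => ?_
  rw [Measure.lintegral_bind (Kernel.aemeasurable _) hφ.aemeasurable,
    lintegral_densityMeasure hqj' hφ]
  have h1 : ∀ x, ∫⁻ y, φ y ∂arKernel h hh q x =
      ∫⁻ y, ENNReal.ofReal (q (y - h x)) * φ y := fun x => by
    rw [arKernel_eq_densityMeasure hqm, lintegral_densityMeasure (by fun_prop) hφ]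
  simp_rw [h1]
  rw [lintegral_lintegral_swap (by fun_prop)]
  refine lintegral_congr fun y => ?_
  have hi : Integrable (fun z => q (y - h z)) μ :=
    integrable_of_abs_le (B := M) (by fun_prop) fun z => by
      rw [abs_of_nonneg (hq.nonneg _)]; exact hM _
  rw [lintegral_mul_const _ (by fun_prop),
    ofReal_integral_eq_lintegral_ofReal hi (Eventually.of_forall fun _ => hq.nonneg _)]

lemma abs_le_affine {r C : ℝ} (hr0 : 0 < r)
    (hcontr : ∀ x, C ≤ |x| → |h x| ≤ r * |x|) (hbdd : ∃ M : ℝ, ∀ x, |x| ≤ C → |h x| ≤ M) :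
    ∃ M : ℝ, 0 ≤ M ∧ ∀ x, |h x| ≤ r * |x| + M := by
  obtain ⟨M, hM⟩ := hbdd
  refine ⟨max M 0, le_max_right _ _, fun x => ?_⟩
  have h1 : 0 ≤ r * |x| := by positivity
  rcases le_total C |x| with hx | hx
  · have := hcontr x hx; have := le_max_right M 0; linarith
  · have := hM x hx; have := le_max_left M 0; linarith

lemma integrable_abs_densityMeasure (hq : IsProbDensity q)
    (hmom : Integrable fun x => |x| * q x) : Integrable (fun x => |x|) (densityMeasure q) := by
  rw [densityMeasure, integrable_withDensity_iff hq.measurable.ennreal_ofReal (by simp)]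
  simpa only [ENNReal.toReal_ofReal (hq.nonneg _)] using hmom

lemma arKernel_drift (hh : Measurable h) (hq : IsProbDensity q)
    (hmom : Integrable fun x => |x| * q x) {r M : ℝ} (hM : ∀ x, |h x| ≤ r * |x| + M) (x : ℝ) :
    Integrable (fun y => |y|) (arKernel h hh q x) ∧
    ∫ y, |y| ∂arKernel h hh q x ≤ r * |x| + (M + ∫ e, |e| ∂densityMeasure q) := by
  have := hq.isProbabilityMeasure
  have hi := integrable_abs_densityMeasure hq hmom
  have hb : Integrable (fun e => |h x| + |e|) (densityMeasure q) := (integrable_const _).add hi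
  have hm : Measurable fun y : ℝ => |y| := by fun_prop
  have hi' : Integrable (fun e => |h x + e|) (densityMeasure q) :=
    hb.mono' (by fun_prop) (Eventually.of_forall fun e => by
      simpa using abs_add_le (h x) e)
  constructor
  · rw [arKernel_apply, integrable_map_measure hm.aestronglyMeasurable (by fun_prop)]
    exact hi'
  · change transOp (arKernel h hh q) _ x ≤ _
    rw [transOp_arKernel hm]
    have h1 := integral_mono hi' hb fun e => abs_add_le (h x) e
    rw [integral_add (integrable_const _) hi] at h1
    simp only [integral_const, probReal_univ, smul_eq_mul, one_mul] at h1
    linarith [hM x]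

/-- For `|x| ≤ R` the shift `h x` stays in `[-H, H]`, so for `y ∈ [0, 1]` the argument `y - h x`
stays in `[-H, 1 + H]`, where `q` has a positive minimum `q u`. The measure `ν` is `q u` times
Lebesgue measure on `[0, 1]`. -/
lemma arKernel_minorization (hh : Measurable h) (hq : IsProbDensity q) (hq_pos : ∀ x, 0 < q x)
    (hq_cont : Continuous q) {r M : ℝ} (hr0 : 0 < r) (hM : ∀ x, |h x| ≤ r * |x| + M) (R : ℝ) :
    ∃ ν : Measure ℝ, IsFiniteMeasure ν ∧ ν ≠ 0 ∧ ∀ x, |x| ≤ R → ν ≤ arKernel h hh q x := by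
  set H : ℝ := max (r * R + M) 0 with hH
  have hH0 : 0 ≤ H := le_max_right _ _
  obtain ⟨u, -, hu⟩ := (isCompact_Icc (a := -H) (b := 1 + H)).exists_isMinOn
    ⟨0, by constructor <;> linarith⟩ hq_cont.continuousOn
  set g : ℝ → ℝ := (Set.Icc (0 : ℝ) 1).indicator fun _ => q u with hg
  have hgm : densityMeasure g = ENNReal.ofReal (q u) • volume.restrict (Set.Icc 0 1) := by
    rw [← withDensity_const, ← withDensity_indicator measurableSet_Icc, densityMeasure]
    congr 1
    ext y
    by_cases hy : y ∈ Set.Icc (0 : ℝ) 1 <;> simp [hg, hy]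
  refine ⟨densityMeasure g, ?_, ?_, fun x hx => ?_⟩
  · rw [hgm]
    exact Measure.smul_finite _ ENNReal.ofReal_ne_top
  · intro h0
    have := congrArg (fun μ : Measure ℝ => μ Set.univ) h0
    simp [hgm] at this
    exact absurd (hq_pos u) (not_lt.mpr this)
  · rw [arKernel_eq_densityMeasure hq.measurable]
    refine densityMeasure_le_of_le fun y => ?_
    by_cases hy : y ∈ Set.Icc (0 : ℝ) 1
    · simp only [hg, Set.indicator_of_mem hy]
      refine hu ?_
      have h1 : |h x| ≤ H := by
        have := hM x
        have h2 : r * |x| ≤ r * R := mul_le_mul_of_nonneg_left hx hr0.le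
        exact le_max_of_le_left (by linarith)
      have h3 := abs_le.mp h1
      constructor <;> linarith [hy.1, hy.2]
    · simp only [hg, Set.indicator_of_notMem hy]
      exact hq.nonneg _

lemma integral_bind_kernel {α : Type*} [MeasurableSpace α] (κ : Kernel α α) [IsMarkovKernel κ]
    (μ : Measure α) [IsProbabilityMeasure μ] {φ : α → ℝ} (hφ : Measurable φ) {B : ℝ}
    (hB : ∀ x, |φ x| ≤ B) : ∫ y, φ y ∂μ.bind κ = ∫ x, transOp κ φ x ∂μ := by
  have hi : Integrable φ ((κ ∘ₖ Kernel.const Unit μ) ()) := integrable_of_abs_le hφ hB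
  have := Kernel.integral_comp (η := κ) (κ := Kernel.const Unit μ) (a := ()) (f := φ) hi
  simpa [Kernel.comp_apply, transOp] using this

instance {α : Type*} [MeasurableSpace α] (κ : Kernel α α) [IsMarkovKernel κ] (μ : Measure α)
    [IsProbabilityMeasure μ] (n : ℕ) :
    IsProbabilityMeasure ((fun μ : Measure α => μ.bind κ)^[n] μ) := by
  induction n with
  | zero => simpa
  | succ n ih => rw [Function.iterate_succ_apply']; infer_instance

lemma integral_iterate_bind {α : Type*} [MeasurableSpace α] (κ : Kernel α α) [IsMarkovKernel κ]
    (μ : Measure α) [IsProbabilityMeasure μ] {φ : α → ℝ} (hφ : Measurable φ) {B : ℝ}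
    (hB : ∀ x, |φ x| ≤ B) (n : ℕ) :
    ∫ y, φ y ∂((fun μ : Measure α => μ.bind κ)^[n] μ) = ∫ x, (transOp κ)^[n] φ x ∂μ := by
  induction n generalizing φ with
  | zero => rfl
  | succ n ih =>
    rw [Function.iterate_succ_apply', integral_bind_kernel κ _ hφ hB,
      ih (measurable_transOp κ hφ) (abs_transOp_le κ hB), Function.iterate_succ_apply]

lemma Invariant.integral_iterate {α : Type*} [MeasurableSpace α] {κ : Kernel α α}
    [IsMarkovKernel κ] {π : Measure α} [IsProbabilityMeasure π] (hπ : κ.Invariant π) {φ : α → ℝ}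
    (hφ : Measurable φ) {B : ℝ} (hB : ∀ x, |φ x| ≤ B) (n : ℕ) :
    ∫ x, (transOp κ)^[n] φ x ∂π = ∫ y, φ y ∂π := by
  rw [← integral_iterate_bind κ π hφ hB n, Function.iterate_fixed (show (fun μ : Measure α => μ.bind κ) π = π from hπ)]

/-- Integrating the iterates against `π` always gives `∫ φ dπ`, while bounded convergence gives `l`.
Uniqueness of the invariant law follows. -/
lemma Invariant.integral_eq_limit {α : Type*} [MeasurableSpace α] {κ : Kernel α α}
    [IsMarkovKernel κ] {π : Measure α} [IsProbabilityMeasure π] (hπ : κ.Invariant π) {φ : α → ℝ}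
    (hφ : Measurable φ) {B : ℝ} (hB : ∀ x, |φ x| ≤ B) {l : ℝ}
    (hl : ∀ x, Tendsto (fun n => (transOp κ)^[n] φ x) atTop (𝓝 l)) : ∫ y, φ y ∂π = l := by
  have h1 : Tendsto (fun n => ∫ x, (transOp κ)^[n] φ x ∂π) atTop (𝓝 (∫ _, l ∂π)) :=
    tendsto_integral_of_dominated_convergence (fun _ => B)
      (fun n => (measurable_iterate_transOp κ hφ n).aestronglyMeasurable) (integrable_const B)
      (fun n => Eventually.of_forall (abs_iterate_transOp_le κ hB n))
      (Eventually.of_forall hl)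
  simp_rw [Invariant.integral_iterate hπ hφ hB] at h1
  simpa using tendsto_nhds_unique tendsto_const_nhds h1

end ARKernel

/-! ### Construction of the invariant density. -/

section Invariant

variable {h q : ℝ → ℝ}

/-- The value `K / (1 - γ)` is the fixed point of `t ↦ γ t + K`, and the start at 0 lies below it.
-/
lemma lintegral_enorm_iterate_bind_le {κ : Kernel ℝ ℝ} [IsMarkovKernel κ] {γ K : ℝ} (hγ0 : 0 ≤ γ)
    (hγ1 : γ < 1) (hK : 0 ≤ K) (hVi : ∀ x, Integrable (fun y => |y|) (κ x))
    (hdrift : ∀ x, ∫ y, |y| ∂κ x ≤ γ * |x| + K) (n : ℕ) :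
    ∫⁻ x, ‖x‖ₑ ∂((fun μ : Measure ℝ => μ.bind κ)^[n] (Measure.dirac 0)) ≤
      ENNReal.ofReal (K / (1 - γ)) := by
  have h1γ : 0 < 1 - γ := by linarith
  have hb : 0 ≤ K / (1 - γ) := by positivity
  induction n with
  | zero => simp
  | succ n ih =>
    rw [Function.iterate_succ_apply', Measure.lintegral_bind (Kernel.aemeasurable _) (by fun_prop)]
    have h1 : ∀ x, ∫⁻ y, ‖y‖ₑ ∂κ x ≤ ENNReal.ofReal γ * ‖x‖ₑ + ENNReal.ofReal K := fun x => by
      have h2 : ∀ y : ℝ, ‖y‖ₑ = ENNReal.ofReal |y| := fun y => by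
        rw [← ofReal_norm, Real.norm_eq_abs]
      simp_rw [h2]
      rw [← ofReal_integral_eq_lintegral_ofReal (hVi x) (Eventually.of_forall fun _ => abs_nonneg _),
        ← ENNReal.ofReal_mul hγ0, ← ENNReal.ofReal_add (by positivity) hK]
      exact ENNReal.ofReal_le_ofReal (hdrift x)
    refine (lintegral_mono h1).trans ?_
    rw [lintegral_add_right _ measurable_const, lintegral_const_mul _ (by fun_prop)]
    simp only [lintegral_const, measure_univ, mul_one]
    calc _ ≤ ENNReal.ofReal γ * ENNReal.ofReal (K / (1 - γ)) + ENNReal.ofReal K := by gcongr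
      _ = ENNReal.ofReal (K / (1 - γ)) := by
        rw [← ENNReal.ofReal_mul hγ0, ← ENNReal.ofReal_add (by positivity) hK]
        congr 1
        field_simp
        ring

/-- If densities `p n` converge pointwise to `p`, are uniformly bounded and have uniformly bounded
first moments, then `p` is a probability density. -/
lemma isProbDensity_of_tendsto {p : ℕ → ℝ → ℝ} {p' : ℝ → ℝ} {M : ℝ} {c : ℝ≥0∞}
    (hp : ∀ n, IsProbDensity (p n)) (hM : ∀ n x, p n x ≤ M)
    (hlim : ∀ x, Tendsto (fun n => p n x) atTop (𝓝 (p' x))) (hc : c ≠ ∞)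
    (hmom : ∀ n, ∫⁻ x, ‖x‖ₑ ∂densityMeasure (p n) ≤ c) : IsProbDensity p' := by
  have hp'm : Measurable p' :=
    measurable_of_tendsto_metrizable (fun n => (hp n).measurable) (tendsto_pi_nhds.2 hlim)
  have hlim' : ∀ x, Tendsto (fun n => ENNReal.ofReal (p n x)) atTop (𝓝 (ENNReal.ofReal (p' x))) :=
    fun x => (ENNReal.continuous_ofReal.tendsto _).comp (hlim x)
  refine ⟨hp'm, fun x => ge_of_tendsto' (hlim x) fun n => (hp n).nonneg x, le_antisymm ?_ ?_⟩
  · calc ∫⁻ x, ENNReal.ofReal (p' x) = ∫⁻ x, liminf (fun n => ENNReal.ofReal (p n x)) atTop :=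
        lintegral_congr fun x => (hlim' x).liminf_eq.symm
      _ ≤ liminf (fun n => ∫⁻ x, ENNReal.ofReal (p n x)) atTop :=
        lintegral_liminf_le fun n => (hp n).measurable.ennreal_ofReal
      _ = 1 := by simp [(hp _).lintegral_eq_one]
  -- Tightness: by Markov's inequality each `p n` leaves mass at most `c / (k + 1)` outside the ball
  -- of radius `k + 1`; inside it, dominated convergence applies.
  · have h1 : ∀ k : ℕ, 1 ≤ (∫⁻ x, ENNReal.ofReal (p' x)) + c / ((k + 1 : ℕ) : ℝ≥0∞) := by
      intro k
      set s : Set ℝ := Metric.ball 0 ((k + 1 : ℕ) : ℝ) with hs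
      have hsm : MeasurableSet s := measurableSet_ball
      have h2 : Tendsto (fun n => ∫⁻ x in s, ENNReal.ofReal (p n x)) atTop
          (𝓝 (∫⁻ x in s, ENNReal.ofReal (p' x))) := by
        refine tendsto_lintegral_of_dominated_convergence (fun _ => ENNReal.ofReal M)
          (fun n => (hp n).measurable.ennreal_ofReal)
          (fun n => Eventually.of_forall fun x => ENNReal.ofReal_le_ofReal (hM n x)) ?_
          (Eventually.of_forall hlim')
        simp only [lintegral_const, Measure.restrict_apply MeasurableSet.univ, Set.univ_inter]
        exact ENNReal.mul_ne_top ENNReal.ofReal_ne_top measure_ball_lt_top.ne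
      have h3 : ∀ n, 1 ≤ (∫⁻ x in s, ENNReal.ofReal (p n x)) + c / ((k + 1 : ℕ) : ℝ≥0∞) := by
        intro n
        have := (hp n).isProbabilityMeasure
        have h4 : densityMeasure (p n) sᶜ ≤ c / ((k + 1 : ℕ) : ℝ≥0∞) := by
          have h5 := meas_ge_le_lintegral_div (μ := densityMeasure (p n)) (f := fun x => ‖x‖ₑ)
            (by fun_prop) (ε := ((k + 1 : ℕ) : ℝ≥0∞)) (by simp) (by simp)
          have h6 : sᶜ ⊆ {x : ℝ | ((k + 1 : ℕ) : ℝ≥0∞) ≤ ‖x‖ₑ} := fun x hx => by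
            have h7 : ((k + 1 : ℕ) : ℝ) ≤ ‖x‖ := by simpa [hs] using hx
            have := ENNReal.ofReal_le_ofReal h7
            rwa [ENNReal.ofReal_natCast, ofReal_norm] at this
          exact (measure_mono h6).trans (h5.trans (ENNReal.div_le_div_right (hmom n) _))
        have h8 : densityMeasure (p n) s = ∫⁻ x in s, ENNReal.ofReal (p n x) := by
          rw [densityMeasure, withDensity_apply _ hsm]
        rw [← h8, ← measure_univ (μ := densityMeasure (p n)), ← measure_add_measure_compl hsm]
        gcongr
      have h9 := ge_of_tendsto' (h2.add_const (c / ((k + 1 : ℕ) : ℝ≥0∞))) h3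
      exact h9.trans (add_le_add_left (setLIntegral_le_lintegral _ _) _)
    have h2 : Tendsto (fun k : ℕ => (∫⁻ x, ENNReal.ofReal (p' x)) + c / ((k + 1 : ℕ) : ℝ≥0∞)) atTop
        (𝓝 ((∫⁻ x, ENNReal.ofReal (p' x)) + 0)) :=
      tendsto_const_nhds.add ((tendsto_add_atTop_iff_nat 1).2
        (by simpa using ENNReal.Tendsto.const_div ENNReal.tendsto_nat_nhds_top (Or.inr hc)))
    simpa using ge_of_tendsto' h2 h1

lemma lintegral_enorm_le_of_tendsto {p : ℕ → ℝ → ℝ} {p' : ℝ → ℝ} {c : ℝ≥0∞}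
    (hp : ∀ n, Measurable (p n)) (hp' : Measurable p')
    (hlim : ∀ x, Tendsto (fun n => p n x) atTop (𝓝 (p' x))) {φ : ℝ → ℝ≥0∞} (hφ : Measurable φ)
    (hφt : ∀ x, φ x ≠ ∞) (hmom : ∀ n, ∫⁻ x, φ x ∂densityMeasure (p n) ≤ c) :
    ∫⁻ x, φ x ∂densityMeasure p' ≤ c := by
  have hlim' : ∀ x, Tendsto (fun n => ENNReal.ofReal (p n x) * φ x) atTop
      (𝓝 (ENNReal.ofReal (p' x) * φ x)) := fun x =>
    ENNReal.Tendsto.mul_const ((ENNReal.continuous_ofReal.tendsto _).comp (hlim x))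
      (Or.inr (hφt x))
  rw [lintegral_densityMeasure hp' hφ]
  calc _ = ∫⁻ x, liminf (fun n => ENNReal.ofReal (p n x) * φ x) atTop :=
        lintegral_congr fun x => (hlim' x).liminf_eq.symm
    _ ≤ liminf (fun n => ∫⁻ x, ENNReal.ofReal (p n x) * φ x) atTop :=
      lintegral_liminf_le fun n => (hp n).ennreal_ofReal.mul hφ
    _ ≤ c := by
      simp_rw [← lintegral_densityMeasure (hp _) hφ]
      exact liminf_le_of_le (by isBoundedDefault) fun b hb => by
        obtain ⟨n, hn⟩ := hb.exists
        exact hn.trans (hmom n)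

lemma isProbDensity_bind (hh : Measurable h) (hq : IsProbDensity q) {M : ℝ} (hM : ∀ x, q x ≤ M)
    (μ : Measure ℝ) [IsProbabilityMeasure μ] : IsProbDensity fun y => ∫ z, q (y - h z) ∂μ := by
  have := isMarkovKernel_arKernel hh hq
  have hqm := hq.measurable
  have hqj : Measurable fun z : ℝ × ℝ => q (z.1 - h z.2) := by fun_prop
  refine ⟨(hqj.stronglyMeasurable.integral_prod_right (ν := μ)).measurable,
    fun y => integral_nonneg fun z => hq.nonneg _, ?_⟩
  have h1 := measure_univ (μ := μ.bind (arKernel h hh q))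
  rwa [bind_arKernel hq hM, densityMeasure, withDensity_apply _ MeasurableSet.univ,
    Measure.restrict_univ] at h1

/-- Existence of a regular invariant density, and geometric ergodicity of the chain. -/
theorem exists_invariantDensity (hh : Measurable h) (hq : IsProbDensity q) (hq_pos : ∀ x, 0 < q x)
    {L : ℝ≥0} (hq_lip : LipschitzWith L q) {M : ℝ} (hM : ∀ x, q x ≤ M)
    (hq_mom : Integrable (fun x => |x| * q x)) {r C : ℝ} (hr0 : 0 < r) (hr1 : r < 1)
    (hcontr : ∀ x, C ≤ |x| → |h x| ≤ r * |x|) (hbdd : ∃ M : ℝ, ∀ x, |x| ≤ C → |h x| ≤ M) :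
    ∃ p : ℝ → ℝ, IsInvariantDensity h hh q p ∧ (∀ x, 0 < p x) ∧ LipschitzWith L p ∧
      (∀ x, p x ≤ M) ∧
      (∀ π : Measure ℝ, IsProbabilityMeasure π → (arKernel h hh q).Invariant π →
        π = densityMeasure p) ∧
      Integrable (fun x => |x|) (densityMeasure p) ∧
      ∃ D ρ : ℝ, 0 ≤ D ∧ 0 < ρ ∧ ρ < 1 ∧ ∀ φ : ℝ → ℝ, Measurable φ → (∀ x, |φ x| ≤ 1) →
        ∀ (n : ℕ) x, |(transOp (arKernel h hh q))^[n] φ x - ∫ y, φ y ∂densityMeasure p| ≤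
          D * ρ ^ n * (1 + |x|) := by
  have hmk := isMarkovKernel_arKernel hh hq
  have hqm := hq.measurable
  obtain ⟨H, hH0, hH⟩ := abs_le_affine hr0 hcontr hbdd
  have hdr := arKernel_drift hh hq hq_mom hH
  have hmin := arKernel_minorization hh hq hq_pos hq_lip.continuous hr0 hH
  set K : ℝ := H + ∫ e, |e| ∂densityMeasure q with hKdef
  have hK : 0 ≤ K := add_nonneg hH0 (integral_nonneg fun _ => abs_nonneg _)
  have hM0 : 0 ≤ M := (hq.nonneg 0).trans (hM 0)
  set κ := arKernel h hh q with hκ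
  obtain ⟨D, ρ, hD, hρ0, hρ1, hconv⟩ := harris_convergence κ (V := fun x => |x|)
    (fun x => abs_nonneg x) hr0.le hr1 hK (fun x => (hdr x).1) (fun x => (hdr x).2) hmin
  have hlim : ∀ B, 0 ≤ B → ∀ φ : ℝ → ℝ, Measurable φ → (∀ x, |φ x| ≤ B) →
      ∃ l : ℝ, (∀ (n : ℕ) x, |(transOp κ)^[n] φ x - l| ≤ D * B * ρ ^ n * (1 + |x|)) ∧
        ∀ x, Tendsto (fun n => (transOp κ)^[n] φ x) atTop (𝓝 l) := by
    intro B hB φ hφ hφB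
    obtain ⟨l, hl⟩ := hconv B hB φ hφ hφB
    refine ⟨l, hl, fun x => tendsto_iff_norm_sub_tendsto_zero.2 ?_⟩
    refine squeeze_zero (fun _ => norm_nonneg _) (fun n => hl n x) ?_
    have := ((tendsto_pow_atTop_nhds_zero_of_lt_one hρ0.le hρ1).const_mul (D * B)).mul_const
      (1 + |x|)
    simpa using this
  -- the densities of the iterates started at the origin, and their limit
  set μ : ℕ → Measure ℝ := fun n => (fun μ : Measure ℝ => μ.bind κ)^[n] (Measure.dirac 0) with hμ
  have hμp : ∀ n, IsProbabilityMeasure (μ n) := fun n => by rw [hμ]; infer_instance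
  have hφm : ∀ y, Measurable fun z => q (y - h z) := fun y => by fun_prop
  have hφM : ∀ y z, |q (y - h z)| ≤ M := fun y z => by
    rw [abs_of_nonneg (hq.nonneg _)]; exact hM _
  choose p' hp' using fun y => hlim M hM0 _ (hφm y) (hφM y)
  set p : ℕ → ℝ → ℝ := fun n y => ∫ z, q (y - h z) ∂μ n with hp
  have hμs : ∀ n, μ (n + 1) = densityMeasure (p n) := fun n => by
    rw [hp, ← bind_arKernel (hh := hh) hq hM, hμ]
    exact Function.iterate_succ_apply' _ _ _
  have hpd : ∀ n, IsProbDensity (p n) := fun n => isProbDensity_bind hh hq hM (μ n)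
  have hpM : ∀ (ν : Measure ℝ) [IsProbabilityMeasure ν] y, ∫ z, q (y - h z) ∂ν ≤ M :=
    fun ν _ y => by
      have := norm_integral_le_of_norm_le_const (μ := ν) (f := fun z => q (y - h z))
        (Eventually.of_forall (hφM y))
      exact (le_abs_self _).trans (by simpa using this)
  -- For fixed `y` this density is an iterate of the bounded function `z ↦ q (y - h z)`, evaluated
  -- at 0.
  have hplim : ∀ y, Tendsto (fun n => p n y) atTop (𝓝 (p' y)) := fun y => by
    have h1 : ∀ n, p n y = (transOp κ)^[n] (fun z => q (y - h z)) 0 := fun n => by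
      exact (integral_iterate_bind κ _ (hφm y) (hφM y) n).trans (by rw [integral_dirac])
    simp_rw [h1]
    exact (hp' y).2 0
  have hmom : ∀ n, ∫⁻ x, ‖x‖ₑ ∂densityMeasure (p n) ≤ ENNReal.ofReal (K / (1 - r)) := fun n => by
    rw [← hμs n]
    exact lintegral_enorm_iterate_bind_le hr0.le hr1 hK (fun x => (hdr x).1)
      (fun x => (hdr x).2) (n + 1)
  have hp'd : IsProbDensity p' :=
    isProbDensity_of_tendsto hpd (fun n => hpM (μ n)) hplim ENNReal.ofReal_ne_top hmom
  set Θ := densityMeasure p' with hΘ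
  have hΘp : IsProbabilityMeasure Θ := hp'd.isProbabilityMeasure
  -- the regular version of the limit density
  set p'' : ℝ → ℝ := fun y => ∫ z, q (y - h z) ∂Θ with hp''
  have hp''d : IsProbDensity p'' := isProbDensity_bind hh hq hM Θ
  have hqi : ∀ (ν : Measure ℝ) [IsProbabilityMeasure ν] y, Integrable (fun z => q (y - h z)) ν :=
    fun ν _ y => integrable_of_abs_le (hφm y) (hφM y)
  -- Fatou in `p (n + 1) y = ∫ p n z * q (y - h z) dz`. Only an inequality results, but both sides
  -- have total mass one, which forces equality almost everywhere.
  have hle : ∀ y, ENNReal.ofReal (p'' y) ≤ ENNReal.ofReal (p' y) := fun y => by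
    have h1 : ∀ (ν : Measure ℝ) [IsProbabilityMeasure ν], ENNReal.ofReal (∫ z, q (y - h z) ∂ν) =
        ∫⁻ z, ENNReal.ofReal (q (y - h z)) ∂ν := fun ν _ =>
      ofReal_integral_eq_lintegral_ofReal (hqi ν y) (Eventually.of_forall fun _ => hq.nonneg _)
    rw [hp'', h1, hΘ]
    have h2 : Tendsto (fun n => ENNReal.ofReal (p (n + 1) y)) atTop (𝓝 (ENNReal.ofReal (p' y))) :=
      (ENNReal.continuous_ofReal.tendsto _).comp ((tendsto_add_atTop_iff_nat 1).2 (hplim y))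
    have h3 : ∀ n, ENNReal.ofReal (p (n + 1) y) =
        ∫⁻ z, ENNReal.ofReal (p n z) * ENNReal.ofReal (q (y - h z)) := fun n => by
      rw [← lintegral_densityMeasure (hpd n).measurable (hφm y).ennreal_ofReal, ← hμs, ← h1]
    simp_rw [h3] at h2
    rw [lintegral_densityMeasure hp'd.measurable (hφm y).ennreal_ofReal, ← h2.liminf_eq]
    refine le_trans (le_of_eq (lintegral_congr fun z => ?_))
      (lintegral_liminf_le fun n => (hpd n).measurable.ennreal_ofReal.mul (hφm y).ennreal_ofReal)
    exact (ENNReal.Tendsto.mul_const ((ENNReal.continuous_ofReal.tendsto _).comp (hplim z))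
      (Or.inr ENNReal.ofReal_ne_top)).liminf_eq.symm
  have hΘ'' : densityMeasure p'' = Θ := by
    refine withDensity_congr_ae ?_
    refine ae_eq_of_ae_le_of_lintegral_le (Eventually.of_forall hle) ?_
      hp'd.measurable.ennreal_ofReal.aemeasurable ?_
    · rw [hp''d.lintegral_eq_one]; simp
    · rw [hp'd.lintegral_eq_one, hp''d.lintegral_eq_one]
  have hinv : κ.Invariant (densityMeasure p'') := by
    rw [hΘ'', Kernel.Invariant, bind_arKernel hq hM]; exact hΘ''
  have hlimΘ : ∀ (ν : Measure ℝ), IsProbabilityMeasure ν → κ.Invariant ν → ∀ φ : ℝ → ℝ,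
      Measurable φ → (∀ x, |φ x| ≤ 1) → ∀ (n : ℕ) x,
      |(transOp κ)^[n] φ x - ∫ y, φ y ∂ν| ≤ D * ρ ^ n * (1 + |x|) := by
    intro ν _ hν φ hφ hφ1 n x
    obtain ⟨l, hl1, hl2⟩ := hlim 1 zero_le_one φ hφ hφ1
    rw [Invariant.integral_eq_limit hν hφ hφ1 hl2]
    simpa using hl1 n x
  have hp''p := hp''d.isProbabilityMeasure
  refine ⟨p'', ⟨hp''d, hinv⟩, fun y => ?_, ?_, hpM Θ, fun π hπ hπinv => ?_, ?_,
    D, ρ, hD, hρ0, hρ1, hlimΘ _ hp''p hinv⟩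
  · rw [hp'', integral_pos_iff_support_of_nonneg (fun _ => hq.nonneg _) (hqi Θ y)]
    have : Function.support (fun z => q (y - h z)) = Set.univ :=
      Set.eq_univ_of_forall fun z => (hq_pos _).ne'
    rw [this]; simp
  · refine LipschitzWith.of_dist_le_mul fun x y => ?_
    rw [hp'', Real.dist_eq, ← integral_sub (hqi Θ x) (hqi Θ y)]
    have h1 : ∀ z, ‖q (x - h z) - q (y - h z)‖ ≤ L * dist x y := fun z => by
      have := hq_lip.dist_le_mul (x - h z) (y - h z)
      simpa [Real.dist_eq] using this
    simpa using norm_integral_le_of_norm_le_const (μ := Θ) (Eventually.of_forall h1)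
  · ext s hs
    have hφ : Measurable (s.indicator (1 : ℝ → ℝ)) := measurable_one.indicator hs
    have hφ1 : ∀ x, |s.indicator (1 : ℝ → ℝ) x| ≤ 1 := fun x => by
      by_cases hx : x ∈ s <;> simp [hx]
    obtain ⟨l, -, hl⟩ := hlim 1 zero_le_one _ hφ hφ1
    have h1 := Invariant.integral_eq_limit hπinv hφ hφ1 hl
    have h2 := Invariant.integral_eq_limit hinv hφ hφ1 hl
    rw [← h2, integral_indicator_one hs, integral_indicator_one hs] at h1
    exact (measureReal_eq_measureReal_iff).1 h1
  · rw [hΘ'']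
    have h1 : ∫⁻ x, ‖x‖ₑ ∂Θ ≤ ENNReal.ofReal (K / (1 - r)) :=
      lintegral_enorm_le_of_tendsto (fun n => (hpd n).measurable) hp'd.measurable hplim
        (by fun_prop) (by simp) hmom
    exact Integrable.abs ⟨by fun_prop, h1.trans_lt ENNReal.ofReal_lt_top⟩

end Invariant

/-! ### Le Cam's inequality in a Banach algebra. -/

section BanachAlgebra

variable {𝔸 : Type*} [NormedRing 𝔸]

lemma norm_pow_sub_pow_le_of_norm_le_one [NormOneClass 𝔸] {x y : 𝔸} (hx : ‖x‖ ≤ 1) (hy : ‖y‖ ≤ 1)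
    (n : ℕ) : ‖x ^ n - y ^ n‖ ≤ n * ‖x - y‖ := by
  induction n with
  | zero => simp
  | succ n ih =>
    have h1 : x ^ (n + 1) - y ^ (n + 1) = x ^ n * (x - y) + (x ^ n - y ^ n) * y := by
      rw [pow_succ, pow_succ]; noncomm_ring
    have h2 : ‖x ^ n‖ ≤ 1 := (norm_pow_le x n).trans (pow_le_one₀ (norm_nonneg _) hx)
    calc ‖x ^ (n + 1) - y ^ (n + 1)‖ ≤ ‖x ^ n‖ * ‖x - y‖ + ‖x ^ n - y ^ n‖ * ‖y‖ := by
          rw [h1]; exact (norm_add_le _ _).trans (add_le_add (norm_mul_le _ _) (norm_mul_le _ _))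
      _ ≤ 1 * ‖x - y‖ + (n * ‖x - y‖) * 1 := by gcongr
      _ = _ := by push_cast; ring

variable [NormedAlgebra ℝ 𝔸] [CompleteSpace 𝔸]

lemma hasSum_exp (x : 𝔸) : HasSum (fun n : ℕ => ((n.factorial : ℝ)⁻¹) • x ^ n) (NormedSpace.exp x) :=
  NormedSpace.exp_series_hasSum_exp' (𝕂 := ℝ) x

lemma hasSum_real_exp (t : ℝ) : HasSum (fun n : ℕ => ((n.factorial : ℝ)⁻¹) * t ^ n) (Real.exp t) := by
  rw [Real.exp_eq_exp_ℝ]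
  exact hasSum_exp t

lemma norm_exp_le [NormOneClass 𝔸] (x : 𝔸) : ‖NormedSpace.exp x‖ ≤ Real.exp ‖x‖ := by
  refine (hasSum_exp x).norm_le_of_bounded (hasSum_real_exp ‖x‖) fun n => ?_
  rw [norm_smul, Real.norm_of_nonneg (by positivity)]
  gcongr
  exact norm_pow_le x n

/-- The exponential series from degree two on is dominated termwise by the real series at `‖x‖`. -/
lemma norm_exp_sub_one_sub_le [NormOneClass 𝔸] {x : 𝔸} (hx : ‖x‖ ≤ 1) :
    ‖NormedSpace.exp x - 1 - x‖ ≤ ‖x‖ ^ 2 := by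
  have h1 := (hasSum_nat_add_iff' 2).2 (hasSum_exp x)
  have h2 := (hasSum_nat_add_iff' 2).2 (hasSum_real_exp ‖x‖)
  simp only [Finset.sum_range_succ, Finset.sum_range_zero] at h1 h2
  have h3 := h1.norm_le_of_bounded h2 fun n => by
    rw [norm_smul, Real.norm_of_nonneg (by positivity)]
    gcongr
    exact norm_pow_le x _
  have h4 := Real.abs_exp_sub_one_sub_id_le (x := ‖x‖) (by simpa using hx)
  simp only [Nat.factorial, pow_zero, pow_one, zero_add, mul_one, Nat.cast_one, inv_one, one_smul,
    one_mul, ← sub_sub] at h3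
  exact h3.trans ((le_abs_self _).trans h4)

lemma exp_smul_sub_one (t : ℝ) (x : 𝔸) :
    NormedSpace.exp (t • (x - 1)) = Real.exp (-t) • NormedSpace.exp (t • x) := by
  let _ : NormedAlgebra ℚ 𝔸 := NormedAlgebra.restrictScalars ℚ ℝ 𝔸
  have h1 : t • (x - 1) = algebraMap ℝ 𝔸 (-t) + t • x := by
    rw [Algebra.algebraMap_eq_smul_one]; module
  rw [h1, NormedSpace.exp_add_of_commute (Algebra.commutes _ _),
    ← NormedSpace.algebraMap_exp_comm (𝕂 := ℝ), ← Real.exp_eq_exp_ℝ, ← Algebra.smul_def]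

/-- **Le Cam's inequality** in a Banach algebra. -/
lemma norm_pow_sub_exp_le [NormOneClass 𝔸] {S : 𝔸} (hS : ‖S‖ ≤ 1) {π δ : ℝ} (hπ0 : 0 ≤ π)
    (hπ1 : π ≤ 1) (hδ0 : 0 ≤ δ) (hδ1 : 2 * δ ≤ 1) (n : ℕ) :
    ‖((1 - π) • (1 : 𝔸) + π • S) ^ n - NormedSpace.exp ((n * δ) • (S - 1))‖ ≤
      n * (2 * |π - δ| + 4 * δ ^ 2) := by
  let _ : NormedAlgebra ℚ 𝔸 := NormedAlgebra.restrictScalars ℚ ℝ 𝔸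
  have hx : ‖(1 - π) • (1 : 𝔸) + π • S‖ ≤ 1 := by
    refine (norm_add_le _ _).trans ?_
    rw [norm_smul, norm_smul, Real.norm_of_nonneg hπ0, Real.norm_of_nonneg (by linarith), norm_one]
    nlinarith
  -- Factoring out the scalar `e^{-δ}` is essential: the crude bound by `exp ‖δ • (S - 1)‖` would
  -- exceed one and spoil the telescoping of powers.
  have hy : ‖NormedSpace.exp (δ • (S - 1))‖ ≤ 1 := by
    rw [exp_smul_sub_one, norm_smul, Real.norm_of_nonneg (Real.exp_nonneg _)]
    calc _ ≤ Real.exp (-δ) * Real.exp ‖δ • S‖ := by gcongr; exact norm_exp_le _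
      _ ≤ Real.exp (-δ) * Real.exp δ := by
        gcongr
        rw [norm_smul, Real.norm_of_nonneg hδ0]
        nlinarith
      _ = 1 := by rw [← Real.exp_add]; simp
  have hS1 : ‖S - 1‖ ≤ 2 := (norm_sub_le _ _).trans (by rw [norm_one]; linarith)
  have hδS : ‖δ • (S - 1)‖ ≤ 2 * δ := by
    rw [norm_smul, Real.norm_of_nonneg hδ0]; nlinarith
  have hpow : NormedSpace.exp ((n * δ) • (S - 1)) = NormedSpace.exp (δ • (S - 1)) ^ n := by
    rw [← NormedSpace.exp_nsmul, ← Nat.cast_smul_eq_nsmul ℝ, smul_smul]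
  rw [hpow]
  refine (norm_pow_sub_pow_le_of_norm_le_one hx hy n).trans ?_
  gcongr
  -- One-step error: a mismatch of the linear coefficients and a second-order remainder.
  have h1 : (1 - π) • (1 : 𝔸) + π • S - NormedSpace.exp (δ • (S - 1)) =
      (π - δ) • (S - 1) - (NormedSpace.exp (δ • (S - 1)) - 1 - δ • (S - 1)) := by module
  rw [h1]
  refine (norm_sub_le _ _).trans (add_le_add ?_ ?_)
  · rw [norm_smul, Real.norm_eq_abs, mul_comm]
    gcongr
  · refine (norm_exp_sub_one_sub_le (hδS.trans hδ1)).trans ?_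
    calc _ ≤ (2 * δ) ^ 2 := by gcongr
      _ = _ := by ring

/-- Here `δ = m / n`, and the exponential is unfolded into powers of `S` with Poisson weights, the
form in which it meets the compound Poisson law. -/
lemma exists_hasSum_norm_pow_sub_le [NormOneClass 𝔸] {S : 𝔸} (hS : ‖S‖ ≤ 1) {π m : ℝ}
    (hπ0 : 0 ≤ π) (hπ1 : π ≤ 1) (hm : 0 ≤ m) {n : ℕ} (hn : 0 < n) (hmn : 2 * m ≤ n) :
    ∃ E, HasSum (fun k : ℕ => (Real.exp (-m) * m ^ k / k.factorial) • S ^ k) E ∧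
      ‖((1 - π) • (1 : 𝔸) + π • S) ^ n - E‖ ≤ n * (2 * |π - m / n| + 4 * (m / n) ^ 2) := by
  have hn' : (0 : ℝ) < n := by exact_mod_cast hn
  have h1 := norm_pow_sub_exp_le hS hπ0 hπ1 (δ := m / n)
    (by positivity) (by rw [← mul_div_assoc, div_le_one hn']; exact hmn) n
  rw [mul_div_cancel₀ _ hn'.ne', exp_smul_sub_one] at h1
  refine ⟨_, ?_, h1⟩
  convert (hasSum_exp (m • S)).const_smul (Real.exp (-m)) using 2 with k
  rw [smul_pow, smul_smul, smul_smul]; congr 1; ring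

end BanachAlgebra

/-! ### Lazy random walk and compound Poisson law. -/

section JumpOp

/-- The operator `u ↦ ∫ u(· + y) ν(dy)`. -/
noncomputable def jumpOp (ν : Measure ℝ) (u : ℝ → ℝ) (s : ℝ) : ℝ := ∫ y, u (s + y) ∂ν

/-- One step of the random walk that stays put with probability `1 - π` and otherwise makes a jump
with law `ν`. -/
noncomputable def lazyJumpOp (ν : Measure ℝ) (π : ℝ) (u : ℝ → ℝ) (s : ℝ) : ℝ :=
  (1 - π) * u s + π * jumpOp ν u s

variable {ν : Measure ℝ} [IsProbabilityMeasure ν] {u v : ℝ → ℝ} {B : ℝ}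

lemma measurable_jumpOp (hu : Measurable u) : Measurable (jumpOp ν u) := by
  have : Measurable fun z : ℝ × ℝ => u (z.1 + z.2) := by fun_prop
  exact (this.stronglyMeasurable.integral_prod_right (ν := ν)).measurable

lemma abs_jumpOp_le (hB : ∀ x, |u x| ≤ B) (s : ℝ) : |jumpOp ν u s| ≤ B := by
  have := norm_integral_le_of_norm_le_const (μ := ν) (f := fun y => u (s + y)) (C := B)
    (Eventually.of_forall fun y => hB _)
  simpa [jumpOp] using this

lemma measurable_iterate_jumpOp (hu : Measurable u) (k : ℕ) : Measurable ((jumpOp ν)^[k] u) := by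
  induction k with
  | zero => exact hu
  | succ k ih => rw [Function.iterate_succ_apply']; exact measurable_jumpOp ih

lemma abs_iterate_jumpOp_le (hB : ∀ x, |u x| ≤ B) (k : ℕ) (s : ℝ) :
    |(jumpOp ν)^[k] u s| ≤ B := by
  induction k generalizing s with
  | zero => exact hB s
  | succ k ih => rw [Function.iterate_succ_apply']; exact abs_jumpOp_le ih s

lemma measurable_lazyJumpOp (π : ℝ) (hu : Measurable u) : Measurable (lazyJumpOp ν π u) :=
  (hu.const_mul _).add ((measurable_jumpOp hu).const_mul _)

lemma abs_lazyJumpOp_le {π : ℝ} (hπ0 : 0 ≤ π) (hπ1 : π ≤ 1) (hB : ∀ x, |u x| ≤ B) (s : ℝ) :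
    |lazyJumpOp ν π u s| ≤ B := by
  have h1 := abs_jumpOp_le (ν := ν) hB s
  have h2 : 0 ≤ 1 - π := by linarith
  calc _ ≤ |(1 - π) * u s| + |π * jumpOp ν u s| := abs_add_le _ _
    _ = (1 - π) * |u s| + π * |jumpOp ν u s| := by
      rw [abs_mul, abs_mul, abs_of_nonneg hπ0, abs_of_nonneg h2]
    _ ≤ (1 - π) * B + π * B := by gcongr; exact hB s
    _ = B := by ring

lemma iterate_jumpOp_lazyJumpOp (π : ℝ) (hu : Measurable u) (hB : ∀ x, |u x| ≤ B) (k : ℕ) (s : ℝ) :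
    (jumpOp ν)^[k] (lazyJumpOp ν π u) s =
      (1 - π) * (jumpOp ν)^[k] u s + π * (jumpOp ν)^[k + 1] u s := by
  induction k generalizing s with
  | zero => rfl
  | succ k ih =>
    rw [Function.iterate_succ_apply', jumpOp]
    simp_rw [ih]
    have hi : ∀ j, Integrable (fun y => (jumpOp ν)^[j] u (s + y)) ν := fun j =>
      integrable_of_abs_le ((measurable_iterate_jumpOp hu j).comp (by fun_prop))
        fun y => abs_iterate_jumpOp_le hB j _
    rw [integral_add ((hi _).const_mul _) ((hi _).const_mul _), integral_const_mul,
      integral_const_mul, Function.iterate_succ_apply' _ (k + 1), Function.iterate_succ_apply' _ k]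
    rfl

instance (k : ℕ) : IsProbabilityMeasure (convPow ν k) := by
  induction k with
  | zero => rw [convPow]; infer_instance
  | succ k ih => rw [convPow]; infer_instance

lemma integral_convPow (hu : Measurable u) (hB : ∀ x, |u x| ≤ B) (k : ℕ) :
    ∫ x, u x ∂convPow ν k = (jumpOp ν)^[k] u 0 := by
  induction k generalizing u with
  | zero => rw [convPow, integral_dirac]; rfl
  | succ k ih =>
    rw [convPow, integral_conv (integrable_of_abs_le hu hB), Function.iterate_succ_apply,
      ← ih (measurable_jumpOp hu) (abs_jumpOp_le hB)]
    rfl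

instance (m : ℝ≥0) : IsProbabilityMeasure (compoundPoisson m ν) := by
  refine ⟨?_⟩
  rw [compoundPoisson, Measure.bind_apply MeasurableSet.univ (by fun_prop)]
  simp

lemma hasSum_compoundPoisson (m : ℝ≥0) (hu : Measurable u) (hB : ∀ x, |u x| ≤ B) :
    HasSum (fun k : ℕ => Real.exp (-m) * m ^ k / k.factorial * (jumpOp ν)^[k] u 0)
      (∫ x, u x ∂compoundPoisson m ν) := by
  let κ : Kernel ℕ ℝ := ⟨convPow ν, by fun_prop⟩
  have hκ : IsMarkovKernel κ := ⟨fun k => inferInstanceAs (IsProbabilityMeasure (convPow ν k))⟩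
  have hi : Integrable u ((κ ∘ₖ Kernel.const Unit (poissonMeasure m)) ()) :=
    integrable_of_abs_le hu hB
  have h1 : ∫ x, u x ∂compoundPoisson m ν = ∫ k, (jumpOp ν)^[k] u 0 ∂poissonMeasure m := by
    have := Kernel.integral_comp (η := κ) (κ := Kernel.const Unit (poissonMeasure m)) (a := ())
      (f := u) hi
    rw [Kernel.comp_apply, Kernel.const_apply] at this
    refine this.trans ?_
    exact integral_congr_ae (Eventually.of_forall fun k => integral_convPow hu hB k)
  rw [h1]
  have h2 : Integrable (fun k : ℕ => (jumpOp ν)^[k] u 0) (poissonMeasure m) :=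
    integrable_of_abs_le (by fun_prop) fun k => abs_iterate_jumpOp_le hB k 0
  simpa using hasSum_integral_poissonMeasure h2

open BoundedContinuousFunction in
/-- The left shift on bounded sequences. -/
noncomputable def seqShift : (ℕ →ᵇ ℝ) →L[ℝ] (ℕ →ᵇ ℝ) :=
  compContinuousCLM ℝ ℝ ⟨fun k : ℕ => k + 1, continuous_of_discreteTopology⟩

open BoundedContinuousFunction in
lemma seqShift_apply (a : ℕ →ᵇ ℝ) (k : ℕ) : seqShift a k = a (k + 1) := rfl

lemma norm_seqShift_le : ‖seqShift‖ ≤ 1 :=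
  ContinuousLinearMap.opNorm_le_bound _ zero_le_one fun a => by
    rw [one_mul]; exact BoundedContinuousFunction.norm_compContinuous_le a _

open BoundedContinuousFunction in
lemma seqShift_pow_apply (a : ℕ →ᵇ ℝ) (n k : ℕ) : (seqShift ^ n) a k = a (k + n) := by
  induction n generalizing k with
  | zero => rfl
  | succ n ih =>
    rw [pow_succ', mul_apply_eq_comp, seqShift_apply, ih]; congr 1; ring

-- Reading `u` through the sequence of its iterates at `s` turns `jumpOp` into the left shift. The
-- Banach algebra is then that of continuous operators on bounded sequences, and no normed space of
-- measurable functions is needed.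
open BoundedContinuousFunction in
lemma lazy_seqShift_pow_apply (π : ℝ) (hu : Measurable u) (hB : ∀ x, |u x| ≤ B)
    (a : ℕ →ᵇ ℝ) (s : ℝ) (ha : ∀ k, a k = (jumpOp ν)^[k] u s) (n : ℕ) :
    ((((1 - π) • 1 + π • seqShift) ^ n : (ℕ →ᵇ ℝ) →L[ℝ] (ℕ →ᵇ ℝ)) a) 0 =
      (lazyJumpOp ν π)^[n] u s := by
  induction n generalizing u a B with
  | zero => exact ha 0
  | succ n ih =>
    rw [pow_succ, mul_apply_eq_comp, Function.iterate_succ_apply]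
    have hB' : ∀ x, |lazyJumpOp ν π u x| ≤ |1 - π| * B + |π| * B := fun x => by
      refine (abs_add_le _ _).trans ?_
      rw [abs_mul, abs_mul]
      gcongr
      · exact hB x
      · exact abs_jumpOp_le hB x
    refine ih (measurable_lazyJumpOp π hu) hB' _ fun k => ?_
    rw [iterate_jumpOp_lazyJumpOp π hu hB, ← ha, ← ha]
    rfl

-- The operator estimate is applied to the sequence of iterates of `u` at 0, of norm at most `B`,
-- and read off at coordinate 0.
open BoundedContinuousFunction in
theorem abs_lazyJumpOp_sub_compoundPoisson_le (hu : Measurable u) (hB : ∀ x, |u x| ≤ B) {π : ℝ}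
    (hπ0 : 0 ≤ π) (hπ1 : π ≤ 1) {m : ℝ≥0} {n : ℕ} (hn : 0 < n) (hm : 2 * (m : ℝ) ≤ n) :
    |(lazyJumpOp ν π)^[n] u 0 - ∫ x, u x ∂compoundPoisson m ν| ≤
      n * (2 * |π - m / n| + 4 * (m / n) ^ 2) * B := by
  have hB0 : 0 ≤ B := (abs_nonneg _).trans (hB 0)
  have hn' : (0 : ℝ) < n := by exact_mod_cast hn
  set a : ℕ →ᵇ ℝ := BoundedContinuousFunction.ofNormedAddCommGroupDiscrete
    (fun k => (jumpOp ν)^[k] u 0) B fun k => abs_iterate_jumpOp_le hB k 0 with ha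
  have haB : ‖a‖ ≤ B := (BoundedContinuousFunction.norm_le hB0).2 fun k =>
    abs_iterate_jumpOp_le hB k 0
  have h1 := lazy_seqShift_pow_apply (ν := ν) π hu hB a 0 (fun k => rfl) n
  have hone : NormOneClass ((ℕ →ᵇ ℝ) →L[ℝ] (ℕ →ᵇ ℝ)) :=
    have : Nontrivial (ℕ →ᵇ ℝ) := ⟨0, 1, fun h => zero_ne_one (DFunLike.congr_fun h 0)⟩
    ⟨ContinuousLinearMap.norm_id⟩
  obtain ⟨E, hE, h3⟩ := exists_hasSum_norm_pow_sub_le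
    (𝔸 := (ℕ →ᵇ ℝ) →L[ℝ] (ℕ →ᵇ ℝ)) norm_seqShift_le hπ0 hπ1 m.2 hn hm
  have h2 : E a 0 = ∫ x, u x ∂compoundPoisson m ν := by
    have h4 := (hE.mapL (ContinuousLinearMap.apply ℝ (ℕ →ᵇ ℝ) a)).mapL
      (BoundedContinuousFunction.evalCLM ℝ (0 : ℕ))
    refine h4.unique ?_
    convert hasSum_compoundPoisson (ν := ν) m hu hB using 2 with k
    have h6 : a k = (jumpOp ν)^[k] u 0 := rfl
    have h7 : (seqShift ^ k) a 0 = a k := by rw [seqShift_pow_apply, zero_add]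
    rw [← h6, ← h7]
    rfl
  rw [← h1, ← h2]
  set W : (ℕ →ᵇ ℝ) →L[ℝ] (ℕ →ᵇ ℝ) := ((1 - π) • 1 + π • seqShift) ^ n - E with hW
  calc _ = ‖W a 0‖ := rfl
    _ ≤ ‖W a‖ := BoundedContinuousFunction.norm_coe_le_norm _ _
    _ ≤ ‖W‖ * ‖a‖ := W.le_opNorm a
    _ ≤ _ := by gcongr; exact h3

end JumpOp

/-! ### Independence and integration. -/

section Independence

variable {Ω : Type*} [MeasurableSpace Ω] {P : Measure Ω} [IsProbabilityMeasure P]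

/-- Both hypotheses together make the joint law of the triple a product of three laws, which can be
reassociated. -/
lemma IndepFun.prodMk_left_of_prodMk_right {α β γ : Type*} [MeasurableSpace α] [MeasurableSpace β]
    [MeasurableSpace γ] {X : Ω → α} {Y : Ω → β} {Z : Ω → γ} (hX : Measurable X)
    (hY : Measurable Y) (hZ : Measurable Z) (hXYZ : IndepFun X (fun ω => (Y ω, Z ω)) P)
    (hYZ : IndepFun Y Z P) : IndepFun (fun ω => (X ω, Y ω)) Z P := by
  have := Measure.isProbabilityMeasure_map (μ := P) hX.aemeasurable
  have := Measure.isProbabilityMeasure_map (μ := P) hY.aemeasurable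
  have := Measure.isProbabilityMeasure_map (μ := P) hZ.aemeasurable
  have hXY : IndepFun X Y P := hXYZ.comp measurable_id measurable_fst
  rw [indepFun_iff_map_prod_eq_prod_map_map (by fun_prop) (by fun_prop)] at *
  rw [hXY, ← MeasurableEquiv.prodAssoc.map_measurableEquiv_injective.eq_iff,
    (measurePreserving_prodAssoc _ _ _).map_eq, ← hYZ, ← hXYZ,
    Measure.map_map (by fun_prop) (by fun_prop)]
  rfl

lemma integral_comp_prodMk_of_indepFun {α β : Type*} [MeasurableSpace α] [MeasurableSpace β]
    {Z : Ω → α} {Y : Ω → β} (hZ : Measurable Z) (hY : Measurable Y) (hZY : IndepFun Z Y P)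
    {F : α × β → ℝ} (hF : Measurable F) (hi : Integrable (fun ω => F (Z ω, Y ω)) P) :
    ∫ ω, F (Z ω, Y ω) ∂P = ∫ ω, ∫ y, F (Z ω, y) ∂(P.map Y) ∂P := by
  have := Measure.isProbabilityMeasure_map (μ := P) hZ.aemeasurable
  have := Measure.isProbabilityMeasure_map (μ := P) hY.aemeasurable
  have h1 := (indepFun_iff_map_prod_eq_prod_map_map hZ.aemeasurable hY.aemeasurable).1 hZY
  have hZYm : Measurable fun ω => (Z ω, Y ω) := hZ.prodMk hY
  have hi' : Integrable F ((P.map Z).prod (P.map Y)) := by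
    rw [← h1, integrable_map_measure hF.aestronglyMeasurable hZYm.aemeasurable]
    exact hi
  rw [← integral_map (φ := fun ω => (Z ω, Y ω)) hZYm.aemeasurable hF.aestronglyMeasurable, h1,
    integral_prod _ hi', integral_map hZ.aemeasurable]
  exact (hF.stronglyMeasurable.integral_prod_right' (ν := P.map Y)).aestronglyMeasurable

end Independence

/-! ### The past of the chain and its Markov property. -/

section Chain

/-- The `σ`-algebra generated by the initial state and the first `k` noise variables. -/
@[reducible] def pastSigma {Ω : Type*} (ε X : ℕ → Ω → ℝ) (k : ℕ) : MeasurableSpace Ω :=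
  MeasurableSpace.comap (fun ω => (X 0 ω, fun j : Finset.range k => ε j ω)) inferInstance

/-- The sum of `f (ε j)` over the visits of the chain to `s` before time `k`. -/
noncomputable def hitSum {Ω : Type*} (f : ℝ → ℝ) (ε X : ℕ → Ω → ℝ) (s : Set ℝ) (k : ℕ) (ω : Ω) : ℝ :=
  ∑ j ∈ Finset.range k, f (ε j ω) * s.indicator 1 (X j ω)

lemma measurable_pastSigma_noise {Ω : Type*} {ε X : ℕ → Ω → ℝ} {j k : ℕ} (hjk : j < k) : Measurable[pastSigma ε X k] (ε j) := by
  have h1 : Measurable[pastSigma ε X k] (fun ω => (X 0 ω, fun j : Finset.range k => ε j ω)) :=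
    comap_measurable _
  have h2 : Measurable fun z : ℝ × (Finset.range k → ℝ) => z.2 ⟨j, Finset.mem_range.2 hjk⟩ := by
    fun_prop
  exact h2.comp h1

lemma measurable_pastSigma_init {Ω : Type*} {ε X : ℕ → Ω → ℝ} (k : ℕ) : Measurable[pastSigma ε X k] (X 0) := by
  have h1 : Measurable[pastSigma ε X k] (fun ω => (X 0 ω, fun j : Finset.range k => ε j ω)) :=
    comap_measurable _
  exact measurable_fst.comp h1

lemma pastSigma_mono {Ω : Type*} {ε X : ℕ → Ω → ℝ} {i k : ℕ} (hik : i ≤ k) : pastSigma ε X i ≤ pastSigma ε X k := by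
  have : Measurable[pastSigma ε X k] (fun ω => (X 0 ω, fun j : Finset.range i => ε j ω)) :=
    (measurable_pastSigma_init k).prodMk (@measurable_pi_lambda _ _ _ (pastSigma ε X k) _ _ fun j =>
      measurable_pastSigma_noise (by have := Finset.mem_range.1 j.2; omega))
  exact this.comap_le

variable {Ω : Type*} [MeasurableSpace Ω] {P : Measure Ω} {h q f : ℝ → ℝ} {ε X : ℕ → Ω → ℝ}

namespace IsStationaryAR

lemma pastSigma_le
    (hS : IsStationaryAR P h q ε X) (k : ℕ) : pastSigma ε X k ≤ ‹MeasurableSpace Ω› := by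
  have h1 := hS.measurable_state 0
  have h2 := hS.measurable_noise
  exact Measurable.comap_le (by fun_prop)

lemma measurable_pastSigma_state
    (hS : IsStationaryAR P h q ε X) (hh : Measurable h) {i k : ℕ} (hik : i ≤ k) :
    Measurable[pastSigma ε X k] (X i) := by
  induction i with
  | zero => exact measurable_pastSigma_init k
  | succ i ih =>
    have h1 : X (i + 1) = fun ω => h (X i ω) + ε i ω := funext fun ω => hS.recursion i ω
    rw [h1]
    exact (hh.comp (ih (by omega))).add (measurable_pastSigma_noise (by omega))

lemma measurable_pastSigma_hitSum
    (hS : IsStationaryAR P h q ε X) (hh : Measurable h) (hf : Measurable f) {s : Set ℝ}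
    (hs : MeasurableSet s) {i k : ℕ} (hik : i ≤ k) :
    Measurable[pastSigma ε X k] (hitSum f ε X s i) := by
  refine @Finset.measurable_fun_sum _ _ _ _ _ _ (pastSigma ε X k) _ _ fun j hj => ?_
  have hj' := Finset.mem_range.1 hj
  exact (hf.comp (measurable_pastSigma_noise (by omega))).mul
    ((measurable_one.indicator hs).comp (hS.measurable_pastSigma_state hh (by omega)))

/-- The variable `ε k` drives the step from `X k` to `X (k + 1)`, and `pastSigma ε X k` sees only `X
0` and the noise of index below `k`. -/
lemma indepFun_noise [IsProbabilityMeasure P]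
    (hS : IsStationaryAR P h q ε X) {β : Type*} [MeasurableSpace β] {Z : Ω → β} {k : ℕ}
    (hZ : Measurable[pastSigma ε X k] Z) : IndepFun Z (ε k) P := by
  have h1 := hS.measurable_state 0
  have h2 := hS.measurable_noise
  have h3 : IndepFun (fun ω (j : Finset.range k) => ε j ω) (ε k) P :=
    (hS.iIndep_noise.indepFun_finset (Finset.range k) {k} (by simp) h2).comp measurable_id
      (measurable_pi_apply (⟨k, by simp⟩ : ({k} : Finset ℕ)))
  have h4 : IndepFun (X 0) (fun ω => ((fun j : Finset.range k => ε j ω), ε k ω)) P := by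
    refine hS.indep_init.comp measurable_id
      (ψ := fun e : ℕ → ℝ => ((fun j : Finset.range k => e j), e k)) (by fun_prop)
  have h5 := IndepFun.prodMk_left_of_prodMk_right h1 (by fun_prop) (h2 k) h4 h3
  rw [IndepFun_iff_Indep] at h5 ⊢
  exact indep_of_indep_of_le_left h5 hZ.comap_le

/-- The Markov property in integrated form: conditioning is replaced by testing against bounded
variables `W` of the past. -/
lemma integral_mul_state_succ [IsProbabilityMeasure P]
    (hS : IsStationaryAR P h q ε X) (hh : Measurable h) {k : ℕ} {W : Ω → ℝ}
    (hW : Measurable[pastSigma ε X k] W) {B : ℝ} (hWB : ∀ ω, |W ω| ≤ B) {φ : ℝ → ℝ}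
    (hφ : Measurable φ) {B' : ℝ} (hφB : ∀ x, |φ x| ≤ B') :
    ∫ ω, W ω * φ (X (k + 1) ω) ∂P = ∫ ω, W ω * transOp (arKernel h hh q) φ (X k ω) ∂P := by
  have hZ : Measurable[pastSigma ε X k] fun ω => (W ω, X k ω) :=
    hW.prodMk (hS.measurable_pastSigma_state hh le_rfl)
  have hZ' := hZ.mono (hS.pastSigma_le k) le_rfl
  have hW' := hW.mono (hS.pastSigma_le k) le_rfl
  have hX := hS.measurable_state
  have hi : Integrable (fun ω => W ω * φ (X (k + 1) ω)) P :=
    integrable_of_abs_le (B := B * B') (by fun_prop) fun ω => by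
      rw [abs_mul]
      exact mul_le_mul (hWB ω) (hφB _) (abs_nonneg _) ((abs_nonneg _).trans (hWB ω))
  have h1 := integral_comp_prodMk_of_indepFun (P := P) hZ' (hS.measurable_noise k)
    (hS.indepFun_noise hZ) (F := fun z : (ℝ × ℝ) × ℝ => z.1.1 * φ (h z.1.2 + z.2))
    (by fun_prop) (by simpa only [hS.recursion] using hi)
  simp only [hS.recursion]
  rw [h1, hS.law_noise]
  refine integral_congr_ae (Eventually.of_forall fun ω => ?_)
  simp only
  rw [integral_const_mul, transOp_arKernel hφ]

lemma integral_mul_state_add [IsProbabilityMeasure P]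
    (hS : IsStationaryAR P h q ε X) (hh : Measurable h) (hq : IsProbDensity q) {i : ℕ} {W : Ω → ℝ}
    (hW : Measurable[pastSigma ε X i] W) {B : ℝ} (hWB : ∀ ω, |W ω| ≤ B) {φ : ℝ → ℝ}
    (hφ : Measurable φ) {B' : ℝ} (hφB : ∀ x, |φ x| ≤ B') (m : ℕ) :
    ∫ ω, W ω * φ (X (i + m) ω) ∂P =
      ∫ ω, W ω * (transOp (arKernel h hh q))^[m] φ (X i ω) ∂P := by
  have := isMarkovKernel_arKernel hh hq
  induction m generalizing φ with
  | zero => rfl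
  | succ m ih =>
    rw [← add_assoc, hS.integral_mul_state_succ hh
        (hW.mono (pastSigma_mono (Nat.le_add_right i m)) le_rfl) hWB hφ hφB,
      ih (measurable_transOp _ hφ) (abs_transOp_le _ hφB), Function.iterate_succ_apply]

lemma map_state
    (hS : IsStationaryAR P h q ε X) (k : ℕ) : P.map (X k) = P.map (X 0) := by
  have h1 := congrArg (fun μ : Measure (ℕ → ℝ) => μ.map fun x => x 0) (hS.stationary k)
  have hX := hS.measurable_state
  rw [Measure.map_map (by fun_prop) (by fun_prop), Measure.map_map (by fun_prop) (by fun_prop)] at h1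
  simpa [Function.comp_def] using h1

lemma invariant_map_state [IsProbabilityMeasure P]
    (hS : IsStationaryAR P h q ε X) (hh : Measurable h) (hq : IsProbDensity q) :
    (arKernel h hh q).Invariant (P.map (X 0)) := by
  have := isMarkovKernel_arKernel hh hq
  have hX := hS.measurable_state
  have h0 := Measure.isProbabilityMeasure_map (μ := P) (hX 0).aemeasurable
  rw [Kernel.Invariant]
  ext s hs
  have hφ : Measurable (s.indicator (1 : ℝ → ℝ)) := measurable_one.indicator hs
  have hφ1 : ∀ x, |s.indicator (1 : ℝ → ℝ) x| ≤ 1 := fun x => by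
    by_cases hx : x ∈ s <;> simp [hx]
  refine (measureReal_eq_measureReal_iff).1 ?_
  have h1 := hS.integral_mul_state_succ hh (k := 0) (W := fun _ => 1) measurable_const (B := 1)
    (by simp) hφ hφ1
  simp only [one_mul, zero_add] at h1
  rw [← integral_indicator_one hs, integral_bind_kernel _ _ hφ hφ1,
    integral_map (hX 0).aemeasurable (measurable_transOp _ hφ).aestronglyMeasurable, ← h1,
    ← hS.map_state 1, ← integral_indicator_one hs,
    integral_map (hX 1).aemeasurable hφ.aestronglyMeasurable]

end IsStationaryAR

end Chain

/-! ### Lindeberg replacement for the sum over visits. -/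

section Lindeberg

variable {Ω : Type*} [MeasurableSpace Ω] {P : Measure Ω} {h q f : ℝ → ℝ} {ε X : ℕ → Ω → ℝ}

lemma indicator_one_nonneg (s : Set ℝ) (x : ℝ) : 0 ≤ s.indicator (1 : ℝ → ℝ) x :=
  Set.indicator_nonneg (by simp) x

lemma indicator_one_le_one (s : Set ℝ) (x : ℝ) : s.indicator (1 : ℝ → ℝ) x ≤ 1 := by
  by_cases hx : x ∈ s <;> simp [hx]

lemma abs_indicator_one_le (s : Set ℝ) (x : ℝ) : |s.indicator (1 : ℝ → ℝ) x| ≤ 1 := by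
  rw [abs_of_nonneg (indicator_one_nonneg s x)]; exact indicator_one_le_one s x

lemma hitSum_succ {Ω : Type*} (f : ℝ → ℝ) (ε X : ℕ → Ω → ℝ) (s : Set ℝ) (k : ℕ) (ω : Ω) :
    hitSum f ε X s (k + 1) ω = hitSum f ε X s k ω + f (ε k ω) * s.indicator 1 (X k ω) :=
  Finset.sum_range_succ _ _

/-- Changing the time changes a function of `hitSum` only if the chain visits `s` in between. -/
lemma abs_sub_hitSum_le {Ω : Type*} (f : ℝ → ℝ) (ε X : ℕ → Ω → ℝ) (s : Set ℝ) {w : ℝ → ℝ} {B : ℝ}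
    (hB : ∀ x, |w x| ≤ B) (i m : ℕ) (ω : Ω) :
    |w (hitSum f ε X s (i + m) ω) - w (hitSum f ε X s i ω)| ≤
      2 * B * ∑ j ∈ Finset.range m, s.indicator (1 : ℝ → ℝ) (X (i + j) ω) := by
  induction m with
  | zero => simp
  | succ m ih =>
    rw [Finset.sum_range_succ, ← add_assoc, hitSum_succ]
    by_cases hx : X (i + m) ω ∈ s
    · have h1 := abs_sub (w (hitSum f ε X s (i + m) ω + f (ε (i + m) ω) *
        s.indicator 1 (X (i + m) ω))) (w (hitSum f ε X s i ω))
      have h2 := hB (hitSum f ε X s (i + m) ω + f (ε (i + m) ω) * s.indicator 1 (X (i + m) ω))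
      have h3 := hB (hitSum f ε X s i ω)
      have hB0 : 0 ≤ B := (abs_nonneg _).trans h3
      have h4 : 0 ≤ ∑ j ∈ Finset.range m, s.indicator (1 : ℝ → ℝ) (X (i + j) ω) :=
        Finset.sum_nonneg fun j _ => indicator_one_nonneg s _
      have h5 : s.indicator (1 : ℝ → ℝ) (X (i + m) ω) = 1 := by simp [hx]
      have h6 := mul_nonneg hB0 h4
      rw [h5] at h1 h2 ⊢
      linarith
    · simpa [hx] using ih

namespace IsStationaryAR

lemma integral_comp_state (hS : IsStationaryAR P h q ε X) {Θ : Measure ℝ}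
    (hΘ : P.map (X 0) = Θ) {φ : ℝ → ℝ} (hφ : Measurable φ) (k : ℕ) :
    ∫ ω, φ (X k ω) ∂P = ∫ x, φ x ∂Θ := by
  rw [← hΘ, ← hS.map_state k,
    integral_map (hS.measurable_state k).aemeasurable hφ.aestronglyMeasurable]

variable [IsProbabilityMeasure P]

lemma integral_mul_comp_add_noise (hS : IsStationaryAR P h q ε X) (hf : Measurable f) {k : ℕ}
    {W T : Ω → ℝ} (hW : Measurable[pastSigma ε X k] W) {B : ℝ} (hWB : ∀ ω, |W ω| ≤ B)
    (hT : Measurable[pastSigma ε X k] T) {u : ℝ → ℝ}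
    (hu : Measurable u) {B' : ℝ} (huB : ∀ x, |u x| ≤ B') :
    ∫ ω, W ω * u (T ω + f (ε k ω)) ∂P =
      ∫ ω, W ω * jumpOp ((densityMeasure q).map f) u (T ω) ∂P := by
  have hZ : Measurable[pastSigma ε X k] fun ω => (W ω, T ω) := hW.prodMk hT
  have hZ' := hZ.mono (hS.pastSigma_le k) le_rfl
  have hW' := hW.mono (hS.pastSigma_le k) le_rfl
  have hT' := hT.mono (hS.pastSigma_le k) le_rfl
  have hε := hS.measurable_noise
  have hi : Integrable (fun ω => W ω * u (T ω + f (ε k ω))) P :=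
    integrable_of_abs_le (B := B * B') (by fun_prop) fun ω => by
      rw [abs_mul]
      exact mul_le_mul (hWB ω) (huB _) (abs_nonneg _) ((abs_nonneg _).trans (hWB ω))
  have h1 := integral_comp_prodMk_of_indepFun (P := P) hZ' (hε k)
    (hS.indepFun_noise hZ) (F := fun z : (ℝ × ℝ) × ℝ => z.1.1 * u (z.1.2 + f z.2))
    (by fun_prop) hi
  rw [h1, hS.law_noise]
  refine integral_congr_ae (Eventually.of_forall fun ω => ?_)
  simp only
  have hg : AEStronglyMeasurable (fun y => u (T ω + y)) ((densityMeasure q).map f) :=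
    (hu.comp (measurable_const_add _)).aestronglyMeasurable
  rw [integral_const_mul, jumpOp, integral_map hf.aemeasurable hg]

/-- The indicator `Y` of a visit takes the values 0 and 1, so `u (T + f(ε) Y) = u T + Y (u (T +
f(ε)) - u T)`. Averaging over the independent `ε k` turns the bracket into `jumpOp u T - u T`, and
the lazy step is the same expression with `π` for `Y`. -/
lemma integral_hitSum_succ_sub (hS : IsStationaryAR P h q ε X) (hh : Measurable h)
    (hf : Measurable f) {s : Set ℝ} (hs : MeasurableSet s)
    {u : ℝ → ℝ} (hu : Measurable u) {B : ℝ} (huB : ∀ x, |u x| ≤ B) (π : ℝ) (k : ℕ) :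
    ∫ ω, u (hitSum f ε X s (k + 1) ω) ∂P -
        ∫ ω, lazyJumpOp ((densityMeasure q).map f) π u (hitSum f ε X s k ω) ∂P =
      ∫ ω, (s.indicator 1 (X k ω) - π) * (jumpOp ((densityMeasure q).map f) u
        (hitSum f ε X s k ω) - u (hitSum f ε X s k ω)) ∂P := by
  have hQ : IsProbabilityMeasure ((densityMeasure q).map f) := by
    have h1 := Measure.isProbabilityMeasure_map (μ := P) (hS.measurable_noise 0).aemeasurable
    rw [hS.law_noise] at h1
    exact Measure.isProbabilityMeasure_map hf.aemeasurable
  set ν := (densityMeasure q).map f with hν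
  set T := hitSum f ε X s k with hT
  have hε := hS.measurable_noise
  have hTm := hS.measurable_pastSigma_hitSum hh hf hs (i := k) le_rfl
  have hTm' : Measurable T := hTm.mono (hS.pastSigma_le k) le_rfl
  have hindm : Measurable (s.indicator (1 : ℝ → ℝ)) := measurable_one.indicator hs
  have hYm : Measurable[pastSigma ε X k] fun ω => s.indicator (1 : ℝ → ℝ) (X k ω) :=
    hindm.comp (hS.measurable_pastSigma_state hh le_rfl)
  have hYm' := hYm.mono (hS.pastSigma_le k) le_rfl
  have hAm : Measurable (jumpOp ν u) := measurable_jumpOp hu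
  have hAB := abs_jumpOp_le (ν := ν) huB
  have hB0 : 0 ≤ B := (abs_nonneg _).trans (huB 0)
  have key := hS.integral_mul_comp_add_noise hf hYm (fun ω => abs_indicator_one_le s _) hTm hu huB
  have hi1 : Integrable (fun ω => u (T ω)) P := integrable_of_abs_le (by fun_prop) fun ω => huB _
  have hi2 : Integrable (fun ω => jumpOp ν u (T ω)) P :=
    integrable_of_abs_le (by fun_prop) fun ω => hAB _
  have hmul : ∀ v : Ω → ℝ, Measurable v → (∀ ω, |v ω| ≤ B) →
      Integrable (fun ω => s.indicator (1 : ℝ → ℝ) (X k ω) * v ω) P := fun v hv hvB =>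
    integrable_of_abs_le (B := 1 * B) (hYm'.mul hv) fun ω => by
      rw [abs_mul]
      exact mul_le_mul (abs_indicator_one_le s _) (hvB ω) (abs_nonneg _) zero_le_one
  have hi3 := hmul (fun ω => u (T ω + f (ε k ω))) (by fun_prop) fun ω => huB _
  have hi4 := hmul (fun ω => u (T ω)) (by fun_prop) fun ω => huB _
  have hi5 := hmul (fun ω => jumpOp ν u (T ω)) (by fun_prop) fun ω => hAB _
  have h1 : ∀ ω, u (hitSum f ε X s (k + 1) ω) =
      u (T ω) + (s.indicator (1 : ℝ → ℝ) (X k ω) * u (T ω + f (ε k ω)) -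
        s.indicator (1 : ℝ → ℝ) (X k ω) * u (T ω)) := fun ω => by
    rw [hitSum_succ]
    by_cases hx : X k ω ∈ s <;> simp [hx, hT]
  have h2 : ∀ ω, (s.indicator 1 (X k ω) - π) * (jumpOp ν u (T ω) - u (T ω)) =
      (s.indicator (1 : ℝ → ℝ) (X k ω) * jumpOp ν u (T ω) -
        s.indicator (1 : ℝ → ℝ) (X k ω) * u (T ω)) -
        (π * jumpOp ν u (T ω) - π * u (T ω)) := fun ω => by ring
  have hi34 : Integrable (fun ω => s.indicator (1 : ℝ → ℝ) (X k ω) * u (T ω + f (ε k ω)) -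
      s.indicator (1 : ℝ → ℝ) (X k ω) * u (T ω)) P := hi3.sub hi4
  have hi54 : Integrable (fun ω => s.indicator (1 : ℝ → ℝ) (X k ω) * jumpOp ν u (T ω) -
      s.indicator (1 : ℝ → ℝ) (X k ω) * u (T ω)) P := hi5.sub hi4
  have hi21 : Integrable (fun ω => π * jumpOp ν u (T ω) - π * u (T ω)) P :=
    (hi2.const_mul _).sub (hi1.const_mul _)
  simp_rw [h1, h2, lazyJumpOp]
  rw [integral_add hi1 hi34, integral_sub hi3 hi4, key,
    integral_add (hi1.const_mul _) (hi2.const_mul _), integral_const_mul, integral_const_mul,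
    integral_sub hi54 hi21, integral_sub hi5 hi4,
    integral_sub (hi2.const_mul _) (hi1.const_mul _), integral_const_mul, integral_const_mul]
  ring

/-- Two visits to `s` at different times are unlikely. -/
lemma integral_indicator_mul_indicator_le (hS : IsStationaryAR P h q ε X) (hh : Measurable h)
    (hq : IsProbDensity q) {Θ : Measure ℝ} (hΘ : P.map (X 0) = Θ) {s : Set ℝ}
    (hs : MeasurableSet s) {c : ℝ} (hc : ∀ x, transOp (arKernel h hh q) (s.indicator 1) x ≤ c)
    (i m : ℕ) :
    ∫ ω, s.indicator (1 : ℝ → ℝ) (X i ω) * s.indicator (1 : ℝ → ℝ) (X (i + (m + 1)) ω) ∂P ≤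
      c * Θ.real s := by
  have hmk := isMarkovKernel_arKernel hh hq
  have hindm : Measurable (s.indicator (1 : ℝ → ℝ)) := measurable_one.indicator hs
  have hYm : Measurable[pastSigma ε X i] fun ω => s.indicator (1 : ℝ → ℝ) (X i ω) :=
    hindm.comp (hS.measurable_pastSigma_state hh le_rfl)
  have hYm' := hYm.mono (hS.pastSigma_le i) le_rfl
  rw [hS.integral_mul_state_add hh hq hYm (fun ω => abs_indicator_one_le s _) hindm
    (abs_indicator_one_le s)]
  have hT0 : ∀ x, 0 ≤ transOp (arKernel h hh q) (s.indicator 1) x := fun x =>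
    integral_nonneg fun y => indicator_one_nonneg s y
  have habs : ∀ x, |transOp (arKernel h hh q) (s.indicator 1) x| ≤ c := fun x => by
    rw [abs_of_nonneg (hT0 x)]; exact hc x
  -- The last step of the chain enters `s` with probability at most `c` from any state; the `m`
  -- steps before it only average this bound.
  have h1 : ∀ x, (transOp (arKernel h hh q))^[m + 1] (s.indicator 1) x ≤ c := fun x => by
    rw [Function.iterate_succ_apply]
    exact (le_abs_self _).trans (abs_iterate_transOp_le _ habs m x)
  have h2 : ∫ ω, s.indicator (1 : ℝ → ℝ) (X i ω) * c ∂P = c * Θ.real s := by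
    rw [integral_mul_const, hS.integral_comp_state hΘ hindm, integral_indicator_one hs, mul_comm]
  rw [← h2]
  have hit := measurable_iterate_transOp (arKernel h hh q) hindm (m + 1)
  have hX := hS.measurable_state i
  refine integral_mono ?_ ?_ fun ω => ?_
  · refine integrable_of_abs_le (B := 1 * 1) (by fun_prop) fun ω => ?_
    rw [abs_mul]
    exact mul_le_mul (abs_indicator_one_le s _)
      (abs_iterate_transOp_le _ (abs_indicator_one_le s) _ _) (abs_nonneg _) zero_le_one
  · exact (integrable_of_abs_le hYm' fun ω => abs_indicator_one_le s _).mul_const c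
  · exact mul_le_mul_of_nonneg_left (h1 _) (indicator_one_nonneg s _)

/-- The increments of the Lindeberg telescope are small, because the chain mixes and because
visits to `s` are rare. -/
lemma abs_integral_indicator_sub_mul_le (hS : IsStationaryAR P h q ε X) (hh : Measurable h)
    (hq : IsProbDensity q) (hf : Measurable f) {Θ : Measure ℝ} (hΘ : P.map (X 0) = Θ)
    (hΘi : Integrable (fun x => |x|) Θ) {s : Set ℝ} (hs : MeasurableSet s) {c : ℝ}
    (hc : ∀ x, transOp (arKernel h hh q) (s.indicator 1) x ≤ c) (hΘc : Θ.real s ≤ c) {D ρ : ℝ}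
    (hD : 0 ≤ D) (hρ : 0 ≤ ρ)
    (hmix : ∀ (n : ℕ) x, |(transOp (arKernel h hh q))^[n] (s.indicator 1) x - Θ.real s| ≤
      D * ρ ^ n * (1 + |x|))
    {w : ℝ → ℝ} (hw : Measurable w) {B : ℝ} (hwB : ∀ x, |w x| ≤ B) (k m : ℕ) :
    |∫ ω, (s.indicator 1 (X k ω) - Θ.real s) * w (hitSum f ε X s k ω) ∂P| ≤
      B * (4 * m * c ^ 2 + D * (1 + ∫ x, |x| ∂Θ) * ρ ^ m) := by
  have hmk := isMarkovKernel_arKernel hh hq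
  have hΘp : IsProbabilityMeasure Θ :=
    hΘ ▸ Measure.isProbabilityMeasure_map (hS.measurable_state 0).aemeasurable
  have hB0 : 0 ≤ B := (abs_nonneg _).trans (hwB 0)
  have hindm : Measurable (s.indicator (1 : ℝ → ℝ)) := measurable_one.indicator hs
  have hX := hS.measurable_state
  have hY0 : ∀ j ω, 0 ≤ s.indicator (1 : ℝ → ℝ) (X j ω) := fun j ω => indicator_one_nonneg s _
  have hY1 : ∀ j ω, s.indicator (1 : ℝ → ℝ) (X j ω) ≤ 1 := fun j ω => indicator_one_le_one s _
  have hYm : ∀ j, Measurable fun ω => s.indicator (1 : ℝ → ℝ) (X j ω) := fun j =>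
    hindm.comp (hX j)
  have hYi : ∀ j, Integrable (fun ω => s.indicator (1 : ℝ → ℝ) (X j ω)) P := fun j =>
    integrable_of_abs_le (hYm j) fun ω => abs_indicator_one_le s _
  have hYE : ∀ j, ∫ ω, s.indicator (1 : ℝ → ℝ) (X j ω) ∂P = Θ.real s := fun j => by
    rw [hS.integral_comp_state hΘ hindm, integral_indicator_one hs]
  have hπ0 : 0 ≤ Θ.real s := measureReal_nonneg
  have hπ1 : Θ.real s ≤ 1 := measureReal_le_one
  have hc0 : 0 ≤ c := hπ0.trans hΘc
  set π := Θ.real s with hπ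
  have hTm : ∀ j, Measurable (hitSum f ε X s j) := fun j =>
    (hS.measurable_pastSigma_hitSum hh hf hs (i := j) le_rfl).mono (hS.pastSigma_le j) le_rfl
  have hZ1 : ∀ ω, |s.indicator (1 : ℝ → ℝ) (X k ω) - π| ≤ 1 := fun ω => by
    rw [abs_le]; constructor <;> linarith [hY0 k ω, hY1 k ω]
  have hmom : 0 ≤ ∫ x, |x| ∂Θ := integral_nonneg fun _ => abs_nonneg _
  have hZw : ∀ j, Integrable (fun ω => (s.indicator (1 : ℝ → ℝ) (X k ω) - π) *
      w (hitSum f ε X s j ω)) P := fun j =>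
    integrable_of_abs_le (B := 1 * B) (((hYm k).sub_const π).mul (hw.comp (hTm j))) fun ω => by
      rw [abs_mul]
      exact mul_le_mul (hZ1 ω) (hwB _) (abs_nonneg _) zero_le_one
  -- replacing the current sum by an earlier one
  have hdiff : ∀ i l, i + l = k → |∫ ω, (s.indicator 1 (X k ω) - π) * w (hitSum f ε X s k ω) ∂P -
      ∫ ω, (s.indicator 1 (X k ω) - π) * w (hitSum f ε X s i ω) ∂P| ≤ B * (4 * l * c ^ 2) := by
    intro i l hil
    have hpair : ∀ j ∈ Finset.range l, ∫ ω, s.indicator (1 : ℝ → ℝ) (X (i + j) ω) *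
        s.indicator (1 : ℝ → ℝ) (X k ω) ∂P ≤ c * c := by
      intro j hj
      have hj' := Finset.mem_range.1 hj
      obtain ⟨r, hr⟩ : ∃ r, k = i + j + (r + 1) := ⟨k - (i + j) - 1, by omega⟩
      rw [hr]
      exact (hS.integral_indicator_mul_indicator_le hh hq hΘ hs hc (i + j) r).trans
        (mul_le_mul_of_nonneg_left hΘc hc0)
    have hYYi : ∀ j, Integrable (fun ω => s.indicator (1 : ℝ → ℝ) (X (i + j) ω) *
        s.indicator (1 : ℝ → ℝ) (X k ω)) P := fun j =>
      integrable_of_abs_le (B := 1 * 1) ((hYm _).mul (hYm k)) fun ω => by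
        rw [abs_mul]
        exact mul_le_mul (abs_indicator_one_le s _) (abs_indicator_one_le s _) (abs_nonneg _)
          zero_le_one
    have hGji : ∀ j, Integrable (fun ω => 2 * B *
        (s.indicator (1 : ℝ → ℝ) (X (i + j) ω) * s.indicator (1 : ℝ → ℝ) (X k ω) +
          π * s.indicator (1 : ℝ → ℝ) (X (i + j) ω))) P := fun j =>
      ((hYYi j).add ((hYi _).const_mul π)).const_mul _
    have hGi : Integrable (fun ω => ∑ j ∈ Finset.range l, 2 * B *
        (s.indicator (1 : ℝ → ℝ) (X (i + j) ω) * s.indicator (1 : ℝ → ℝ) (X k ω) +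
          π * s.indicator (1 : ℝ → ℝ) (X (i + j) ω))) P :=
      integrable_finsetSum _ fun j _ => hGji j
    rw [← integral_sub (hZw k) (hZw i)]
    refine (abs_integral_le_of_abs_le hGi fun ω => ?_).trans ?_
    · rw [← mul_sub, abs_mul]
      have h1 := abs_sub_hitSum_le f ε X s hwB i l ω
      rw [hil] at h1
      -- This splits the error into joint visits and products of single visit probabilities, each at
      -- most `c²`.
      have h2 : |s.indicator (1 : ℝ → ℝ) (X k ω) - π| ≤ s.indicator (1 : ℝ → ℝ) (X k ω) + π := by
        rw [abs_le]; constructor <;> linarith [hY0 k ω]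
      refine (mul_le_mul h2 h1 (abs_nonneg _) (add_nonneg (hY0 k ω) hπ0)).trans (le_of_eq ?_)
      rw [Finset.mul_sum, Finset.mul_sum]
      exact Finset.sum_congr rfl fun j _ => by ring
    · rw [integral_finsetSum _ fun j _ => hGji j]
      calc _ ≤ ∑ _j ∈ Finset.range l, 2 * B * (c * c + c * c) := by
            refine Finset.sum_le_sum fun j hj => ?_
            rw [integral_const_mul, integral_add (hYYi j) ((hYi _).const_mul π),
              integral_const_mul, hYE]
            have h1 : π * π ≤ c * c := mul_le_mul hΘc hΘc hπ0 hc0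
            have h2 := hpair j hj
            gcongr
        _ = _ := by rw [Finset.sum_const, Finset.card_range, nsmul_eq_mul]; ring
  -- the earlier sum is almost uncorrelated with the current visit
  have htail : 0 ≤ D * (1 + ∫ x, |x| ∂Θ) * ρ ^ m := by positivity
  rcases le_or_gt m k with hmk' | hmk'
  · obtain ⟨i, hi⟩ : ∃ i, i + m = k := ⟨k - m, by omega⟩
    have hd := hdiff i m hi
    have hwm : Measurable[pastSigma ε X i] fun ω => w (hitSum f ε X s i ω) :=
      hw.comp (hS.measurable_pastSigma_hitSum hh hf hs le_rfl)
    have hwm' := hwm.mono (hS.pastSigma_le i) le_rfl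
    have hit := measurable_iterate_transOp (arKernel h hh q) hindm m
    have hitB := abs_iterate_transOp_le (arKernel h hh q) (abs_indicator_one_le s) m
    have h1 := hS.integral_mul_state_add hh hq hwm (fun ω => hwB _) hindm
      (abs_indicator_one_le s) m
    rw [hi] at h1
    have hwi : Integrable (fun ω => w (hitSum f ε X s i ω)) P :=
      integrable_of_abs_le hwm' fun ω => hwB _
    have hwYi : Integrable (fun ω => w (hitSum f ε X s i ω) *
        s.indicator (1 : ℝ → ℝ) (X k ω)) P :=
      integrable_of_abs_le (B := B * 1) (hwm'.mul (hYm k)) fun ω => by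
        rw [abs_mul]
        exact mul_le_mul (hwB _) (abs_indicator_one_le s _) (abs_nonneg _) hB0
    have hwTi : Integrable (fun ω => w (hitSum f ε X s i ω) *
        (transOp (arKernel h hh q))^[m] (s.indicator 1) (X i ω)) P :=
      integrable_of_abs_le (B := B * 1) (hwm'.mul (hit.comp (hX i))) fun ω => by
        rw [abs_mul]
        exact mul_le_mul (hwB _) (hitB _) (abs_nonneg _) hB0
    -- The factor `w` now depends only on the past of time `i`, so the visit at time `k` may be
    -- replaced by its `m`-step transition probability.
    have h2 : ∫ ω, (s.indicator 1 (X k ω) - π) * w (hitSum f ε X s i ω) ∂P =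
        ∫ ω, w (hitSum f ε X s i ω) *
          ((transOp (arKernel h hh q))^[m] (s.indicator 1) (X i ω) - π) ∂P := by
      simp_rw [sub_mul, mul_sub]
      rw [integral_sub hwTi (hwi.mul_const π), ← h1, ← integral_sub hwYi (hwi.mul_const π)]
      exact integral_congr_ae (Eventually.of_forall fun ω => by simp only; ring)
    have hVi : Integrable (fun ω => 1 + |X i ω|) P := by
      refine (integrable_const 1).add ?_
      have : Integrable (fun x => |x|) (P.map (X i)) := by rw [hS.map_state, hΘ]; exact hΘi
      exact this.comp_measurable (hX i)
    have hVE : ∫ ω, (1 + |X i ω|) ∂P = 1 + ∫ x, |x| ∂Θ := by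
      rw [hS.integral_comp_state hΘ (φ := fun x => 1 + |x|) (by fun_prop),
        integral_add (integrable_const _) hΘi]
      simp
    have h3 : |∫ ω, (s.indicator 1 (X k ω) - π) * w (hitSum f ε X s i ω) ∂P| ≤
        B * (D * (1 + ∫ x, |x| ∂Θ) * ρ ^ m) := by
      rw [h2]
      refine (abs_integral_le_of_abs_le (G := fun ω => B * (D * ρ ^ m) * (1 + |X i ω|))
        (hVi.const_mul _) fun ω => ?_).trans (le_of_eq ?_)
      · rw [abs_mul, mul_assoc]
        exact mul_le_mul (hwB _) (hmix m _) (abs_nonneg _) hB0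
      · rw [integral_const_mul, hVE]; ring
    have h4 := abs_add_le (∫ ω, (s.indicator 1 (X k ω) - π) * w (hitSum f ε X s k ω) ∂P -
      ∫ ω, (s.indicator 1 (X k ω) - π) * w (hitSum f ε X s i ω) ∂P)
      (∫ ω, (s.indicator 1 (X k ω) - π) * w (hitSum f ε X s i ω) ∂P)
    rw [sub_add_cancel] at h4
    linarith
  -- With fewer than `m` steps available, going back to time 0 suffices: the empty sum is constant
  -- and the centred indicator has mean zero by stationarity.
  · have hd := hdiff 0 k (zero_add k)
    have h1 : ∫ ω, (s.indicator 1 (X k ω) - π) * w (hitSum f ε X s 0 ω) ∂P = 0 := by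
      have : ∀ ω, hitSum f ε X s 0 ω = 0 := fun ω => by simp [hitSum]
      simp_rw [this]
      rw [integral_mul_const, integral_sub (hYi k) (integrable_const _), hYE]
      simp
    rw [h1, sub_zero] at hd
    have h2 : (4 * k * c ^ 2 : ℝ) ≤ 4 * m * c ^ 2 := by gcongr
    have h3 := mul_le_mul_of_nonneg_left h2 hB0
    have h4 := mul_nonneg hB0 htail
    linarith

/-- Comparison of the sum over visits with the lazy random walk. -/
lemma abs_integral_hitSum_sub_le (hS : IsStationaryAR P h q ε X) (hh : Measurable h)
    (hq : IsProbDensity q) (hf : Measurable f) {Θ : Measure ℝ} (hΘ : P.map (X 0) = Θ)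
    (hΘi : Integrable (fun x => |x|) Θ) {s : Set ℝ} (hs : MeasurableSet s) {c : ℝ}
    (hc : ∀ x, transOp (arKernel h hh q) (s.indicator 1) x ≤ c) (hΘc : Θ.real s ≤ c) {D ρ : ℝ}
    (hD : 0 ≤ D) (hρ : 0 ≤ ρ)
    (hmix : ∀ (n : ℕ) x, |(transOp (arKernel h hh q))^[n] (s.indicator 1) x - Θ.real s| ≤
      D * ρ ^ n * (1 + |x|))
    {u : ℝ → ℝ} (hu : Measurable u) {B : ℝ} (huB : ∀ x, |u x| ≤ B) (k m : ℕ) :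
    |∫ ω, u (hitSum f ε X s k ω) ∂P -
        (lazyJumpOp ((densityMeasure q).map f) (Θ.real s))^[k] u 0| ≤
      k * (2 * B * (4 * m * c ^ 2 + D * (1 + ∫ x, |x| ∂Θ) * ρ ^ m)) := by
  have hQ := hq.isProbabilityMeasure
  have hν : IsProbabilityMeasure ((densityMeasure q).map f) :=
    Measure.isProbabilityMeasure_map hf.aemeasurable
  have hΘp : IsProbabilityMeasure Θ :=
    hΘ ▸ Measure.isProbabilityMeasure_map (hS.measurable_state 0).aemeasurable
  induction k generalizing u with
  | zero => simp [hitSum]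
  | succ k ih =>
    -- The last step is exchanged for a lazy one; the induction hypothesis for `lazyJumpOp u`, still
    -- bounded by `B`, handles the first `k` steps.
    have h1 := ih (measurable_lazyJumpOp (ν := (densityMeasure q).map f) (Θ.real s) hu)
      (abs_lazyJumpOp_le measureReal_nonneg measureReal_le_one huB)
    have h2 := hS.integral_hitSum_succ_sub hh hf hs hu huB (Θ.real s) k
    have hwB : ∀ x, |jumpOp ((densityMeasure q).map f) u x - u x| ≤ 2 * B := fun x => by
      have h3 := abs_jumpOp_le (ν := (densityMeasure q).map f) huB x
      have h4 := huB x
      have h5 := abs_sub (jumpOp ((densityMeasure q).map f) u x) (u x)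
      linarith
    have h3 := hS.abs_integral_indicator_sub_mul_le hh hq hf hΘ hΘi hs hc hΘc hD hρ hmix
      (w := fun x => jumpOp ((densityMeasure q).map f) u x - u x) ((measurable_jumpOp hu).sub hu)
      (B := 2 * B) hwB k m
    rw [← h2] at h3
    rw [Function.iterate_succ_apply]
    refine (abs_sub_le _ _ _).trans ((add_le_add h3 h1).trans (le_of_eq ?_))
    push_cast
    ring

end IsStationaryAR

end Lindeberg

/-! ### Choice of parameters and the rate. -/

section Rate

lemma measureReal_densityMeasure {p : ℝ → ℝ} (hp : IsProbDensity p) {s : Set ℝ}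
    (hs : MeasurableSet s) : (densityMeasure p).real s = ∫ x in s, p x := by
  rw [← integral_indicator_one hs, integral_densityMeasure hp.measurable hp.nonneg,
    ← integral_indicator hs]
  congr 1
  ext x
  by_cases hx : x ∈ s <;> simp [hx]

lemma measureReal_densityMeasure_Icc_le {p : ℝ → ℝ} (hp : IsProbDensity p) {M : ℝ}
    (hM : ∀ x, p x ≤ M) {b : ℝ} (hb : 0 ≤ b) :
    (densityMeasure p).real (Set.Icc 0 b) ≤ M * b := by
  rw [measureReal_densityMeasure hp measurableSet_Icc]
  have h1 := norm_setIntegral_le_of_norm_le_const (μ := volume) (s := Set.Icc 0 b) (f := p) (C := M)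
    measure_Icc_lt_top fun x _ => by
      rw [Real.norm_of_nonneg (hp.nonneg x)]; exact hM x
  rw [Real.volume_real_Icc_of_le hb, sub_zero] at h1
  exact (Real.le_norm_self _).trans h1

lemma abs_measureReal_densityMeasure_Icc_sub_le {p : ℝ → ℝ} (hp : IsProbDensity p) {L : ℝ≥0}
    (hL : LipschitzWith L p) {b : ℝ} (hb : 0 ≤ b) :
    |(densityMeasure p).real (Set.Icc 0 b) - p 0 * b| ≤ L * b ^ 2 := by
  rw [measureReal_densityMeasure hp measurableSet_Icc]
  have hv : volume.real (Set.Icc 0 b) = b := by rw [Real.volume_real_Icc_of_le hb, sub_zero]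
  have h0 : ∫ _ in Set.Icc 0 b, p 0 = p 0 * b := by
    rw [setIntegral_const, hv, smul_eq_mul, mul_comm]
  rw [← h0, ← integral_sub (hL.continuous.integrableOn_Icc) (by simp)]
  have h1 := norm_setIntegral_le_of_norm_le_const (μ := volume) (s := Set.Icc 0 b)
    (f := fun x => p x - p 0) (C := L * b) measure_Icc_lt_top fun x hx => by
      have h2 := hL.dist_le_mul x 0
      rw [Real.dist_eq, Real.dist_eq, sub_zero, abs_of_nonneg hx.1] at h2
      exact h2.trans (mul_le_mul_of_nonneg_left hx.2 L.2)
  rw [hv] at h1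
  exact h1.trans (le_of_eq (by ring))

/-- For `m` of order `log n`, the geometric term `ρ ^ m` is at most `n⁻²`. -/
lemma exists_nat_le_log_pow_le {ρ : ℝ} (hρ0 : 0 < ρ) (hρ1 : ρ < 1) {x : ℝ} (hx : 1 ≤ Real.log x)
    (hx0 : 0 < x) :
    ∃ m : ℕ, (m : ℝ) ≤ (2 / (-Real.log ρ) + 1) * Real.log x ∧ ρ ^ m ≤ (x ^ 2)⁻¹ := by
  have hl : 0 < -Real.log ρ := by linarith [Real.log_neg hρ0 hρ1]
  refine ⟨⌈2 * Real.log x / (-Real.log ρ)⌉₊, ?_, ?_⟩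
  · have h1 := (Nat.ceil_lt_add_one (a := 2 * Real.log x / (-Real.log ρ)) (by positivity)).le
    refine h1.trans ?_
    rw [add_mul, div_mul_eq_mul_div]
    linarith
  · have h1 := Nat.le_ceil (2 * Real.log x / (-Real.log ρ))
    rw [div_le_iff₀ hl] at h1
    rw [← Real.exp_log (show (0 : ℝ) < (x ^ 2)⁻¹ by positivity),
      ← Real.exp_log (show 0 < ρ ^ ⌈2 * Real.log x / (-Real.log ρ)⌉₊ by positivity),
      Real.log_inv, Real.log_pow, Real.log_pow]
    apply Real.exp_le_exp.2
    push_cast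
    linarith

/-- Distribution functions increase, so a uniform distance between them bounds the Lévy distance. -/
lemma levyDist_le {μ ν : Measure ℝ} {a : ℝ} (ha : 0 < a)
    (h : ∀ x, |μ.real (Set.Iic x) - ν.real (Set.Iic x)| ≤ a) [IsFiniteMeasure μ] :
    levyDist μ ν ≤ a := by
  refine csInf_le ⟨0, fun b hb => hb.1.le⟩ ⟨ha, fun x => ⟨?_, ?_⟩⟩
  · have h1 := (abs_le.1 (h x)).2
    have h2 : μ.real (Set.Iic (x - a)) ≤ μ.real (Set.Iic x) :=
      measureReal_mono (Set.Iic_subset_Iic.2 (by linarith))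
    linarith
  · have h1 := (abs_le.1 (h x)).1
    have h2 : μ.real (Set.Iic x) ≤ μ.real (Set.Iic (x + a)) :=
      measureReal_mono (Set.Iic_subset_Iic.2 (by linarith))
    linarith

lemma abs_measureReal_map_Iic_sub_le {Ω : Type*} [MeasurableSpace Ω] {P : Measure Ω}
    {S : Ω → ℝ} (hS : Measurable S) {μ : Measure ℝ} {a : ℝ}
    (hSa : ∀ u : ℝ → ℝ, Measurable u → (∀ x, |u x| ≤ 1) →
      |∫ ω, u (S ω) ∂P - ∫ x, u x ∂μ| ≤ a) (x : ℝ) :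
    |(P.map S).real (Set.Iic x) - μ.real (Set.Iic x)| ≤ a := by
  have hu : Measurable ((Set.Iic x).indicator (1 : ℝ → ℝ)) :=
    measurable_one.indicator measurableSet_Iic
  have h1 := hSa _ hu (abs_indicator_one_le _)
  rwa [← integral_map hS.aemeasurable hu.aestronglyMeasurable,
    integral_indicator_one measurableSet_Iic, integral_indicator_one measurableSet_Iic] at h1

variable {Ω : Type*} [MeasurableSpace Ω] {P : Measure Ω} [IsProbabilityMeasure P]
  {h q f p : ℝ → ℝ} {ε X : ℕ → Ω → ℝ}

/-- The telescope is used with `c = M / n` and `m` of order `log n`, then Le Cam with `δ = p 0 / n`.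
The condition `3 ≤ n` gives `log n ≥ 1`, so that terms of order `1 / n` are absorbed; `2 * p 0 ≤ n`
is the smallness required by Le Cam. -/
theorem IsStationaryAR.abs_integral_arSum_sub_compoundPoisson_le (hS : IsStationaryAR P h q ε X)
    (hh : Measurable h) (hq : IsProbDensity q) {M : ℝ} (hqM : ∀ x, q x ≤ M) (hf : Measurable f)
    (hp : IsProbDensity p) (hpM : ∀ x, p x ≤ M) {L : ℝ≥0} (hpL : LipschitzWith L p)
    (hlaw : P.map (X 0) = densityMeasure p)
    (hmom : Integrable (fun x => |x|) (densityMeasure p)) {D ρ : ℝ} (hD : 0 ≤ D) (hρ0 : 0 < ρ)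
    (hρ1 : ρ < 1)
    (hmix : ∀ φ : ℝ → ℝ, Measurable φ → (∀ x, |φ x| ≤ 1) → ∀ (n : ℕ) x,
      |(transOp (arKernel h hh q))^[n] φ x - ∫ y, φ y ∂densityMeasure p| ≤ D * ρ ^ n * (1 + |x|))
    {u : ℝ → ℝ} (hu : Measurable u) {B : ℝ} (huB : ∀ x, |u x| ≤ B) {n : ℕ} (hn : 3 ≤ n)
    (hnp : 2 * p 0 ≤ n) :
    |∫ ω, u (arSum f ε X n ω) ∂P -
        ∫ x, u x ∂compoundPoisson (p 0).toNNReal ((densityMeasure q).map f)| ≤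
      (8 * M ^ 2 * (2 / (-Real.log ρ) + 1) + 2 * (D * (1 + ∫ x, |x| ∂densityMeasure p)) +
        2 * L + 4 * p 0 ^ 2) * B * (Real.log n / n) := by
  have hQ := hq.isProbabilityMeasure
  have hν : IsProbabilityMeasure ((densityMeasure q).map f) :=
    Measure.isProbabilityMeasure_map hf.aemeasurable
  have hΘp := hp.isProbabilityMeasure
  have hB0 : 0 ≤ B := (abs_nonneg _).trans (huB 0)
  have hn0 : 0 < n := by omega
  have hn' : (0 : ℝ) < n := by exact_mod_cast hn0
  have hlog : 1 ≤ Real.log n := by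
    rw [Real.le_log_iff_exp_le hn']
    have h3 : (3 : ℝ) ≤ n := by exact_mod_cast hn
    linarith [Real.exp_one_lt_d9]
  obtain ⟨m, hm, hρm⟩ := exists_nat_le_log_pow_le hρ0 hρ1 hlog hn'
  have hb : (0 : ℝ) ≤ 1 / n := by positivity
  set s : Set ℝ := Set.Icc 0 (1 / (n : ℝ)) with hs
  have hsm : MeasurableSet s := measurableSet_Icc
  have hvs : volume.real s = 1 / n := by rw [hs, Real.volume_real_Icc_of_le hb, sub_zero]
  set π := (densityMeasure p).real s with hπ
  have hmix' : ∀ (k : ℕ) x, |(transOp (arKernel h hh q))^[k] (s.indicator 1) x - π| ≤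
      D * ρ ^ k * (1 + |x|) := fun k x => by
    have := hmix (s.indicator 1) (measurable_one.indicator hsm) (abs_indicator_one_le s) k x
    rwa [integral_indicator_one hsm] at this
  have h1 := hS.abs_integral_hitSum_sub_le hh hq hf hlaw hmom hsm (c := M * (1 / n))
    (fun x => by
      rw [← hvs]; exact transOp_arKernel_le_of_bounded hq hqM hsm measure_Icc_lt_top.ne x)
    (measureReal_densityMeasure_Icc_le hp hpM hb) hD hρ0.le hmix' hu huB n m
  have hp0 : ((p 0).toNNReal : ℝ) = p 0 := Real.coe_toNNReal _ (hp.nonneg 0)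
  have h2 := abs_lazyJumpOp_sub_compoundPoisson_le (ν := (densityMeasure q).map f) hu huB
    (π := π) measureReal_nonneg measureReal_le_one (m := (p 0).toNNReal) hn0
    (by rw [hp0]; exact hnp)
  rw [hp0] at h2
  have h3 := abs_measureReal_densityMeasure_Icc_sub_le hp hpL hb
  rw [← hs, ← hπ, mul_one_div] at h3
  set E := D * (1 + ∫ x, |x| ∂densityMeasure p) with hE
  have hE0 : 0 ≤ E := by
    have : 0 ≤ ∫ x, |x| ∂densityMeasure p := integral_nonneg fun _ => abs_nonneg _
    positivity
  have hln : 1 / (n : ℝ) ≤ Real.log n / n := by gcongr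
  have h4 : (n : ℝ) * (2 * B * (4 * m * (M * (1 / n)) ^ 2 + E * ρ ^ m)) ≤
      (8 * M ^ 2 * (2 / (-Real.log ρ) + 1) + 2 * E) * B * (Real.log n / n) := by
    calc (n : ℝ) * (2 * B * (4 * m * (M * (1 / n)) ^ 2 + E * ρ ^ m))
        ≤ (n : ℝ) * (2 * B * (4 * ((2 / (-Real.log ρ) + 1) * Real.log n) * (M * (1 / n)) ^ 2 +
          E * ((n : ℝ) ^ 2)⁻¹)) := by gcongr
      _ = 8 * M ^ 2 * (2 / (-Real.log ρ) + 1) * B * (Real.log n / n) + 2 * E * B * (1 / n) := by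
        field_simp
        ring
      _ ≤ 8 * M ^ 2 * (2 / (-Real.log ρ) + 1) * B * (Real.log n / n) +
          2 * E * B * (Real.log n / n) := by gcongr
      _ = _ := by ring
  have h5 : (n : ℝ) * (2 * |π - p 0 / n| + 4 * (p 0 / n) ^ 2) * B ≤
      (2 * L + 4 * p 0 ^ 2) * B * (Real.log n / n) := by
    calc (n : ℝ) * (2 * |π - p 0 / n| + 4 * (p 0 / n) ^ 2) * B
        ≤ n * (2 * (L * (1 / n) ^ 2) + 4 * (p 0 / n) ^ 2) * B := by gcongr
      _ = (2 * L + 4 * p 0 ^ 2) * B * (1 / n) := by field_simp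
      _ ≤ _ := by gcongr
  have h6 := abs_sub_le (∫ ω, u (hitSum f ε X s n ω) ∂P)
    ((lazyJumpOp ((densityMeasure q).map f) π)^[n] u 0)
    (∫ x, u x ∂compoundPoisson (p 0).toNNReal ((densityMeasure q).map f))
  calc _ ≤ _ := h6
    _ ≤ _ := add_le_add (h1.trans h4) (h2.trans h5)
    _ = _ := by ring

lemma tendsto_log_natCast_div : Tendsto (fun n : ℕ => Real.log n / n) atTop (𝓝 0) :=
  Real.isLittleO_log_id_atTop.tendsto_div_nhds_zero.comp tendsto_natCast_atTop_atTop

/-- Weakens the rate obtained to the one asserted. -/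
lemma log_natCast_div_le {n : ℕ} (hn : 1 ≤ n) :
    Real.log n / n ≤ (n : ℝ) ^ (-(1 / 2) : ℝ) * Real.log n := by
  have h1 : (1 : ℝ) ≤ n := by exact_mod_cast hn
  rw [div_eq_mul_inv, mul_comm, ← Real.rpow_neg_one]
  exact mul_le_mul_of_nonneg_right (Real.rpow_le_rpow_of_exponent_le h1 (by norm_num))
    (Real.log_nonneg h1)

/-- Weak convergence from a bound on bounded measurable test functions. -/
lemma tendstoInDistribution_of_abs_integral_sub_le {S : ℕ → Ω → ℝ} (hS : ∀ n, Measurable (S n))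
    {μ : Measure ℝ} [IsProbabilityMeasure μ] {a : ℕ → ℝ} {N : ℕ} (ha : Tendsto a atTop (𝓝 0))
    (hSa : ∀ n ≥ N, ∀ (u : ℝ → ℝ) (B : ℝ), Measurable u → (∀ x, |u x| ≤ B) →
      |∫ ω, u (S n ω) ∂P - ∫ x, u x ∂μ| ≤ B * a n) :
    TendstoInDistribution S atTop id (fun _ => P) μ := by
  refine ⟨fun n => (hS n).aemeasurable, aemeasurable_id, ?_⟩
  refine ProbabilityMeasure.tendsto_iff_forall_integral_tendsto.2 fun g => ?_
  change Tendsto (fun n => ∫ x, g x ∂P.map (S n)) atTop (𝓝 (∫ x, g x ∂μ.map id))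
  rw [Measure.map_id]
  have hg : Measurable g := g.continuous.measurable
  have h1 : ∀ n, ∫ x, g x ∂P.map (S n) = ∫ ω, g (S n ω) ∂P := fun n =>
    integral_map (hS n).aemeasurable hg.aestronglyMeasurable
  simp_rw [h1]
  rw [tendsto_iff_norm_sub_tendsto_zero]
  refine squeeze_zero' (Eventually.of_forall fun _ => norm_nonneg _)
    ((eventually_ge_atTop N).mono fun n hn => hSa n hn g ‖g‖ hg fun x => g.norm_coe_le_norm x) ?_
  simpa using ha.const_mul ‖g‖

end Rate

/-! ### The main theorem. -/

theorem corollary2p1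
    (q : ℝ → ℝ) (hq : IsProbDensity q) (hq_pos : ∀ x, 0 < q x)
    (hq_lip : ∃ L : ℝ≥0, LipschitzWith L q) (hq_bdd : ∃ M : ℝ, ∀ x, q x ≤ M)
    (hq_mom : Integrable (fun x => |x| * q x))
    (h : ℝ → ℝ) (hh : Measurable h)
    (r C : ℝ) (hr0 : 0 < r) (hr1 : r < 1) (hcontr : ∀ x, C ≤ |x| → |h x| ≤ r * |x|)
    (hbdd : ∃ M : ℝ, ∀ x, |x| ≤ C → |h x| ≤ M) :
    ∃ p : ℝ → ℝ,
      -- `p` is an invariant density, positive, Lipschitz continuous and bounded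
      IsInvariantDensity h hh q p ∧
      (∀ x, 0 < p x) ∧ (∃ L : ℝ≥0, LipschitzWith L p) ∧ (∃ M : ℝ, ∀ x, p x ≤ M) ∧
      -- uniqueness, among invariant densities and among invariant probability measures
      (∀ p' : ℝ → ℝ, IsInvariantDensity h hh q p' → p' =ᵐ[volume] p) ∧
      (∀ π : Measure ℝ, IsProbabilityMeasure π → (arKernel h hh q).Invariant π →
        π = densityMeasure p) ∧
      -- compound Poisson limit and rate of convergence for the stationary chain
      ∀ f : ℝ → ℝ, Measurable f → Integrable f (densityMeasure q) →
        (∃ C' : ℝ, ∃ N : ℕ, ∀ n ≥ N, ∀ z ∈ Set.Icc (0 : ℝ) (1 / (n : ℝ)),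
          ∀ x ∈ Set.Icc (0 : ℝ) (1 / (n : ℝ)), |f (z - h x)| ≤ C') →
        ∃ K : ℝ, 0 < K ∧ ∃ N : ℕ,
          ∀ (Ω : Type*) [MeasurableSpace Ω] (P : Measure Ω) [IsProbabilityMeasure P]
            (ε X : ℕ → Ω → ℝ), IsStationaryAR P h q ε X →
            (∃ _ : IsProbabilityMeasure
                (compoundPoisson (p 0).toNNReal ((densityMeasure q).map f)),
              TendstoInDistribution (arSum f ε X) atTop id (fun _ => P)
                (compoundPoisson (p 0).toNNReal ((densityMeasure q).map f))) ∧
            ∀ n ≥ N,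
              levyDist (P.map (arSum f ε X n))
                  (compoundPoisson (p 0).toNNReal ((densityMeasure q).map f))
                ≤ K * (n : ℝ) ^ (-(1 / 2) : ℝ) * Real.log n := by

  obtain ⟨Lq, hLq⟩ := hq_lip
  obtain ⟨M, hM⟩ := hq_bdd
  obtain ⟨p, hp, hp_pos, hpL, hpM, huniq, hmom, D, ρ, hD, hρ0, hρ1, hmix⟩ :=
    exists_invariantDensity hh hq hq_pos hLq hM hq_mom hr0 hr1 hcontr hbdd
  refine ⟨p, hp, hp_pos, ⟨Lq, hpL⟩, ⟨M, hpM⟩, fun p' hp' => ?_, huniq, fun f hf _ _ => ?_⟩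
  · have h1 := huniq _ hp'.1.isProbabilityMeasure hp'.2
    have h2 := (withDensity_eq_iff hp'.1.measurable.ennreal_ofReal.aemeasurable
      hp.1.measurable.ennreal_ofReal.aemeasurable (by rw [hp'.1.lintegral_eq_one]; simp)).1 h1
    filter_upwards [h2] with x hx
    rwa [ENNReal.ofReal_eq_ofReal_iff (hp'.1.nonneg x) (hp.1.nonneg x)] at hx
  · have hQ := hq.isProbabilityMeasure
    have hν : IsProbabilityMeasure ((densityMeasure q).map f) :=
      Measure.isProbabilityMeasure_map hf.aemeasurable
    -- Fixed before the probability space and the chain are introduced, hence uniform over all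
    -- stationary solutions.
    set K : ℝ := 8 * M ^ 2 * (2 / (-Real.log ρ) + 1) +
      2 * (D * (1 + ∫ x, |x| ∂densityMeasure p)) + 2 * Lq + 4 * p 0 ^ 2 with hK
    have hK0 : 0 < K := by
      have h1 : 0 ≤ ∫ x, |x| ∂densityMeasure p := integral_nonneg fun _ => abs_nonneg _
      have h2 : 0 < -Real.log ρ := by linarith [Real.log_neg hρ0 hρ1]
      have h3 := hp_pos 0
      positivity
    set N : ℕ := max 3 ⌈2 * p 0⌉₊ with hN
    refine ⟨K, hK0, N, fun Ω _ P _ ε X hS => ?_⟩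
    have hlaw : P.map (X 0) = densityMeasure p :=
      huniq _ (Measure.isProbabilityMeasure_map (hS.measurable_state 0).aemeasurable)
        (hS.invariant_map_state hh hq)
    have hmeas : ∀ n, Measurable (arSum f ε X n) := fun n =>
      (hS.measurable_pastSigma_hitSum hh hf measurableSet_Icc (i := n) le_rfl).mono
        (hS.pastSigma_le n) le_rfl
    have key : ∀ n ≥ N, ∀ (u : ℝ → ℝ) (B : ℝ), Measurable u → (∀ x, |u x| ≤ B) →
        |∫ ω, u (arSum f ε X n ω) ∂P -
          ∫ x, u x ∂compoundPoisson (p 0).toNNReal ((densityMeasure q).map f)| ≤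
        B * (K * (Real.log n / n)) := by
      intro n hn u B hu huB
      refine (hS.abs_integral_arSum_sub_compoundPoisson_le hh hq hM hf hp.1 hpM hpL hlaw hmom hD
        hρ0 hρ1 hmix hu huB ((le_max_left _ _).trans hn)
        ((Nat.le_ceil _).trans (by exact_mod_cast (le_max_right _ _).trans hn))).trans
        (le_of_eq ?_)
      ring
    refine ⟨⟨inferInstance, tendstoInDistribution_of_abs_integral_sub_le hmeas
      (by simpa using tendsto_log_natCast_div.const_mul K) key⟩, fun n hn => ?_⟩
    have hn3 : 3 ≤ n := (le_max_left _ _).trans hn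
    have hn1 : (1 : ℝ) < n := by exact_mod_cast (by omega : 1 < n)
    have hlog : 0 < Real.log n := Real.log_pos hn1
    have := Measure.isProbabilityMeasure_map (μ := P) (hmeas n).aemeasurable
    refine levyDist_le (by positivity) fun x => ?_
    refine abs_measureReal_map_Iic_sub_le (hmeas n) (fun u hu hu1 => ?_) x
    refine (key n hn u 1 hu hu1).trans ?_
    rw [one_mul, mul_assoc]
    exact mul_le_mul_of_nonneg_left (log_natCast_div_le (by omega)) hK0.le
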